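/- **Setting.** Let $\mathfrak h$ be a finite dimensional real vector space and $I$ a finite index set. Let $(\mathfrak h,(H_i,L_i)_{i\in I})$ be a linear Coxeter system: $H_i=\mathbb R_{\ge0}h_i\subseteq\mathfrak h$ and $L_i=\mathbb R_{\ge0}\alpha_i\subseteq\mathfrak h^*$ are rays, with generators normalised by $\alpha_i(h_i)=2$; the closed chamber $\overline C=\{\lambda\in\mathfrak h^*\mid \lambda(h_i)\ge0\ \forall i\in I\}$ spans $\mathfrak h^*$; the cones $\overline C\cap\{\lambda\mid\lambda(h_i)=0\}$, $i\in I$, are pairwise different and are exactly the faces of codimension one of $\overline C$ (codimension in $\mathfrak h^*$); and, with $C=\{\lambda\mid\lambda(h_i)>0\ \forall i\in I\}$ and $\mathcal W$ the group generated by the reflections $\sigma_i(\lambda)=\lambda-\lambda(h_i)\alpha_i$, $i\in I$, of $\mathfrak h^*$, one has $\sigma C\cap C=\emptyset$ for all $1\ne\sigma\in\mathcal W$. For $J\subseteq I$ let $\mathcal W_J$ be the subgroup generated by the $\sigma_j$, $j\in J$. The Tits cone is $X=\bigcup_{\sigma\in\mathcal W}\sigma\overline C$. Let $Y\subseteq X$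 be a $\mathcal W$-invariant convex cone containing $0$. Let $Fa(Y)$ be the complete lattice of nonempty faces of $Y$, ordered by inclusion, with intersection as meet, and let $$\Upsilon=\{R\in Fa(Y)\mid \mathrm{ri}(R)\cap\overline C\neq\emptyset\},$$ where $\mathrm{ri}$ denotes the relative interior. For $R\in\Upsilon$ put $\upsilon(R)=\{i\in I\mid\sigma_iR=R\}$, $\upsilon_*(R)=\{i\in I\mid\sigma_i\text{ fixes }R\text{ pointwise}\}$ and $\upsilon^*(R)=\upsilon(R)\setminus\upsilon_*(R)$. **Theorem.** 1. $\Upsilon$ is a complete sublattice of $Fa(Y)$: it contains the biggest and the smallest face of $Y$, and it is closed under the meets and joins, formed in $Fa(Y)$, of arbitrary families. 2. For every finite chain $R_1\subseteq\dots\subseteq R_m$ in $Fa(Y)$ there is exactly one chain $S_1\subseteq\dots\subseteq S_m$ of faces from $\Upsilon$ for which there exists $\sigma\in\mathcal W$ with $R_i=\sigma S_i$ for all $i$. 3. $\upsilon:\Upsilon\to\mathcal P(I)$ is a regular type map. That is, $\Upsilon$ is a lower semilattice with a biggest element $1$, one has $\upsilon(1)=I$, and the set $\mathcal F(\Upsilon,\upsilon)=\{(R,\sigma\mathcal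 W_{\upsilon(R)})\mid R\in\Upsilon,\ \sigma\in\mathcal W\}$ is a lower semilattice with biggest element $(1,\mathcal W)$ under the partial order $$(R_1,\sigma_1\mathcal W_{\upsilon(R_1)})\le(R_2,\sigma_2\mathcal W_{\upsilon(R_2)})\iff R_1\subseteq R_2\ \text{ and }\ \sigma_1\mathcal W_{\upsilon(R_1)}\cap\sigma_2\mathcal W_{\upsilon(R_2)}\ne\emptyset .$$ Moreover $(R,\sigma\mathcal W_{\upsilon(R)})\mapsto\sigma R$ is a well-defined isomorphism of ordered sets $\mathcal F(\Upsilon,\upsilon)\cong Fa(Y)$. 4. Let $\mathcal R(Y)$ be the quotient of the monoid $\mathcal W\ltimes Fa(Y)$, with product $(\sigma,R)(\tau,T)=(\sigma\tau,\tau^{-1}R\cap T)$ and unit $(1,Y)$, by the congruence: $(\sigma,R)\sim(\sigma',R')$ iff $R=R'$ and $\sigma^{-1}\sigma'$ fixes $R$ pointwise. Write $\sigma\lceil R\rceil$ for the class of $(\sigma,R)$. Suppose that $\mathcal W$ acts faithfully on $Y$. Then $\sigma\mapsto\sigma\lceil Y\rceil$ is an isomorphism from $\mathcal W$ onto the unit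 group $\mathcal R(Y)^\times$, and $R\mapsto1\lceil R\rceil$ is an isomorphism of ordered sets from $Fa(Y)$ onto the idempotents $E(\mathcal R(Y))$, ordered by $e\le f\iff ef=fe=e$. The triple $(\mathcal R,\Lambda,\mathcal S)$ given by $\mathcal R=\mathcal R(Y)$, $\Lambda=\{1\lceil R\rceil\mid R\in\Upsilon\}$, $\mathcal S=\{\sigma_i\lceil Y\rceil\mid i\in I\}$ is a generalized Renner–Coxeter system, that is: * (a) $E(\mathcal R)$ is a commutative submonoid of $\mathcal R$, and $\mathcal R=\mathcal R^\times E(\mathcal R)=E(\mathcal R)\mathcal R^\times$; * (b) $(\mathcal R^\times,\mathcal S)$ is a Coxeter system; * (c) $\Lambda$ is a sub-semilattice of $E(\mathcal R)$ and meets every orbit of $\mathcal R^\times$ acting on $E(\mathcal R)$ by conjugation in exactly one element; * (d) for all $e_1\le e_2$ in $E(\mathcal R)$ there are $x\in\mathcal R^\times$ and $f_1\le f_2$ in $\Lambda$ with $e_k=xf_kx^{-1}$ for $k=1,2$; * (e) for every $e\in\Lambda$ the subgroups $\{x\in\mathcal R^\times\mid xe=ex\}$ and $\{x\in\mathcal R^\times\mid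 xe=ex=e\}$ of $\mathcal R^\times$ are generated by subsets of $\mathcal S$; * (f) $e\le f$ in $\Lambda$ implies $\lambda^*(e)\subseteq\lambda^*(f)$, where $\lambda^*(e)=\{s\in\mathcal S\mid se=es\ne e\}$. Moreover $i\mapsto\sigma_i\lceil Y\rceil$ is injective on $I$, and for $R\in\Upsilon$ and $e=1\lceil R\rceil$ the sets $\{s\in\mathcal S\mid se=es\}$, $\{s\in\mathcal S\mid se=es=e\}$ and $\lambda^*(e)$ are the images under it of $\upsilon(R)$, $\upsilon_*(R)$ and $\upsilon^*(R)$, respectively. -/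

import Mathlib

/-! ### Faces of a convex cone containing zero -/

section Faces

variable {E : Type*} [AddCommGroup E] [Module ℝ E]

/-- `Fa(K)`: the nonempty faces of the convex cone with zero `K`, ordered by inclusion. -/
abbrev FaceLattice (K : PointedCone ℝ E) : Type _ := {F : PointedCone ℝ E // F.IsFaceOf K}

/-- The face lattice is a complete lattice whose meet is the intersection of faces. -/
noncomputable instance FaceLattice.instCompleteLattice (K : PointedCone ℝ E) :
    CompleteLattice (FaceLattice K) :=
  letI : InfSet (FaceLattice K) :=
    ⟨fun S => ⟨K ⊓ sInf (Subtype.val '' S), PointedCone.IsFaceOf.sInf _ (by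
      rintro _ ⟨F, -, rfl⟩
      exact F.2)⟩⟩
  { completeLatticeOfInf (FaceLattice K) (by
      intro S
      constructor
      · intro F hF
        exact (inf_le_right.trans (sInf_le ⟨F, hF, rfl⟩) :
          K ⊓ sInf (Subtype.val '' S) ≤ F.1)
      · intro G hG
        refine le_inf G.2.le (le_sInf ?_)
        rintro _ ⟨F, hF, rfl⟩
        exact hG hF) with
    inf := fun F G => ⟨F.1 ⊓ G.1, F.2.inf_left G.2⟩
    inf_le_left := fun F G => (inf_le_left : F.1 ⊓ G.1 ≤ F.1)
    inf_le_right := fun F G => (inf_le_right : F.1 ⊓ G.1 ≤ G.1)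
    le_inf := fun _ _ _ h₁ h₂ => le_inf (α := PointedCone ℝ E) h₁ h₂
    top := ⟨K, PointedCone.IsFaceOf.refl K⟩
    le_top := fun F => F.2.le }

theorem FaceLattice.coe_inf {K : PointedCone ℝ E} (F G : FaceLattice K) :
    ((F ⊓ G : FaceLattice K) : PointedCone ℝ E) = F.1 ⊓ G.1 := rfl

theorem FaceLattice.coe_top {K : PointedCone ℝ E} :
    ((⊤ : FaceLattice K) : PointedCone ℝ E) = K := rfl

end Faces

/-! ### Linear Coxeter systems -/

section Chamber

variable {ι V : Type*} [NormedAddCommGroup V] [NormedSpace ℝ V]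

/-- The closed fundamental chamber: all `lam` in the dual space with `lam (h i) ≥ 0` for all `i`. -/
def closedChamber (h : ι → V) : PointedCone ℝ (StrongDual ℝ V) where
  carrier := {lam | ∀ i, 0 ≤ lam (h i)}
  add_mem' := fun ha hb i => add_nonneg (ha i) (hb i)
  zero_mem' := fun _ => le_refl _
  smul_mem' := fun c _ ha i => mul_nonneg c.2 (ha i)

/-- The open fundamental chamber: all `lam` with `lam (h i) > 0` for all `i`. -/
def openChamber (h : ι → V) : Set (StrongDual ℝ V) := {lam | ∀ i, 0 < lam (h i)}

/-- The intersection of the closed chamber with the hyperplane `lam (h i) = 0`. -/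
def chamberWall (h : ι → V) (i : ι) : PointedCone ℝ (StrongDual ℝ V) where
  carrier := {lam | (∀ j, 0 ≤ lam (h j)) ∧ lam (h i) = 0}
  add_mem' := fun {a b} ha hb =>
    ⟨fun j => add_nonneg (ha.1 j) (hb.1 j), show a (h i) + b (h i) = 0 by rw [ha.2, hb.2, add_zero]⟩
  zero_mem' := ⟨fun _ => le_refl _, rfl⟩
  smul_mem' := fun c {a} ha =>
    ⟨fun j => mul_nonneg c.2 (ha.1 j), show (c : ℝ) * a (h i) = 0 by rw [ha.2, mul_zero]⟩

/-- The reflection `lam ↦ lam - lam(h) • α` of the dual space, where `α(h) = 2`. -/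
noncomputable def dualReflection (h : V) (α : StrongDual ℝ V) (hα : α h = 2) :
    StrongDual ℝ V ≃ₗ[ℝ] StrongDual ℝ V :=
  Module.reflection (x := α)
    (f := (ContinuousLinearMap.apply ℝ ℝ h : StrongDual ℝ V →L[ℝ] ℝ).toLinearMap) hα

theorem dualReflection_apply (h : V) (α : StrongDual ℝ V) (hα : α h = 2) (lam : StrongDual ℝ V) :
    dualReflection h α hα lam = lam - lam h • α :=
  rfl

end Chamber

/-- A linear Coxeter system on `V`, indexed by `ι`.  The zero-based closed rays are
`H_i = ℝ≥0 • h i` in `V` and `L_i = ℝ≥0 • α i` in the dual of `V`; as `L_i` without zero lies in the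
open half-space of `H_i`, generators can be and are normalised by `α_i(h_i) = 2`. -/
structure LinearCoxeterSystem (ι V : Type*) [NormedAddCommGroup V] [NormedSpace ℝ V] where
  /-- generators of the rays in `V` -/
  h : ι → V
  /-- generators of the rays in the dual space -/
  α : ι → StrongDual ℝ V
  pairing : ∀ i, α i (h i) = 2
  /-- the closed chamber spans the dual space -/
  span_chamber : Submodule.span ℝ (closedChamber h : Set (StrongDual ℝ V)) = ⊤
  /-- the walls are precisely the faces of codimension one of the chamber ... -/
  facets : ∀ F : PointedCone ℝ (StrongDual ℝ V),
    (F.IsFaceOf (closedChamber h) ∧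
      Module.finrank ℝ (Submodule.span ℝ (F : Set (StrongDual ℝ V))) + 1 =
        Module.finrank ℝ (StrongDual ℝ V)) ↔ ∃ i, F = chamberWall h i
  /-- ... and they are pairwise different -/
  wall_injective : Function.Injective (chamberWall h)
  /-- nontrivial elements of the group generated by the reflections move the open chamber
  off itself -/
  disjoint_chamber : ∀ σ ∈ Subgroup.closure
      (Set.range fun i => dualReflection (h i) (α i) (pairing i)),
    σ ≠ 1 → Disjoint (σ '' openChamber h) (openChamber h)

namespace LinearCoxeterSystem

variable {ι V : Type*} [NormedAddCommGroup V] [NormedSpace ℝ V] (D : LinearCoxeterSystem ι V)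

/-- The linear Coxeter group, generated by the simple reflections. -/
noncomputable def group : Subgroup (StrongDual ℝ V ≃ₗ[ℝ] StrongDual ℝ V) :=
  Subgroup.closure (Set.range fun i => dualReflection (D.h i) (D.α i) (D.pairing i))

/-- The linear Coxeter group as a type. -/
abbrev W : Type _ := ↥D.group

/-- The simple reflections. -/
noncomputable def simple (i : ι) : D.W :=
  ⟨dualReflection (D.h i) (D.α i) (D.pairing i), Subgroup.subset_closure ⟨i, rfl⟩⟩

/-- The closed fundamental chamber. -/
def chamber : PointedCone ℝ (StrongDual ℝ V) := closedChamber D.h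

/-- The Tits cone, the union of the translates of the closed chamber. -/
def titsCone : Set (StrongDual ℝ V) := {lam | ∃ σ : D.W, ∃ μ ∈ D.chamber, σ.1 μ = lam}

end LinearCoxeterSystem

/-- A convex subcone of the Tits cone which contains zero and is invariant under the linear
Coxeter group. -/
structure InvariantSubcone {ι V : Type*} [NormedAddCommGroup V] [NormedSpace ℝ V]
    (D : LinearCoxeterSystem ι V) where
  cone : PointedCone ℝ (StrongDual ℝ V)
  invariant : ∀ σ : D.W, ∀ lam ∈ cone, σ.1 lam ∈ cone
  subset_titsCone : (cone : Set (StrongDual ℝ V)) ⊆ D.titsCone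

namespace InvariantSubcone

variable {ι V : Type*} [NormedAddCommGroup V] [NormedSpace ℝ V]
  {D : LinearCoxeterSystem ι V} (Y : InvariantSubcone D)

/-- The face lattice `Fa(Y)`. -/
abbrev Face : Type _ := FaceLattice Y.cone

theorem map_cone (σ : D.W) :
    Y.cone.map (σ.1 : StrongDual ℝ V →ₗ[ℝ] StrongDual ℝ V) = Y.cone := by
  ext lam
  rw [PointedCone.mem_map]
  constructor
  · rintro ⟨μ, hμ, rfl⟩
    exact Y.invariant σ μ hμ
  · intro hl
    exact ⟨σ.1⁻¹ lam, Y.invariant σ⁻¹ lam hl, LinearEquiv.apply_symm_apply σ.1 lam⟩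

/-- The group acts on faces by taking images: `σ • F = {σ lam | lam ∈ F}`. -/
noncomputable instance : MulAction D.W Y.Face where
  smul σ F := ⟨F.1.map (σ.1 : StrongDual ℝ V →ₗ[ℝ] StrongDual ℝ V), by
    have := F.2.map_equiv σ.1
    rwa [Y.map_cone σ] at this⟩
  one_smul F := Subtype.ext (PointedCone.map_id F.1)
  mul_smul σ τ F := Subtype.ext (PointedCone.map_map
    (σ.1 : StrongDual ℝ V →ₗ[ℝ] StrongDual ℝ V) (τ.1 : StrongDual ℝ V →ₗ[ℝ] StrongDual ℝ V)
    F.1).symm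

theorem mem_smul_iff {Y : InvariantSubcone D} (σ : D.W) (F : Y.Face) (lam : StrongDual ℝ V) :
    lam ∈ (σ • F).1 ↔ σ⁻¹.1 lam ∈ F.1 := by
  change lam ∈ F.1.map (σ.1 : StrongDual ℝ V →ₗ[ℝ] StrongDual ℝ V) ↔ _
  rw [PointedCone.mem_map]
  constructor
  · rintro ⟨μ, hμ, rfl⟩
    have : σ⁻¹.1 (σ.1 μ) = μ := LinearEquiv.symm_apply_apply σ.1 μ
    change σ⁻¹.1 (σ.1 μ) ∈ F.1
    rwa [this]
  · intro hl
    exact ⟨_, hl, LinearEquiv.apply_symm_apply σ.1 lam⟩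

theorem smul_inf {Y : InvariantSubcone D} (σ : D.W) (F G : Y.Face) :
    σ • (F ⊓ G) = σ • F ⊓ σ • G := by
  apply Subtype.ext
  ext lam
  rw [FaceLattice.coe_inf, Submodule.mem_inf, mem_smul_iff, mem_smul_iff, mem_smul_iff,
    FaceLattice.coe_inf, Submodule.mem_inf]

theorem smul_top {Y : InvariantSubcone D} (σ : D.W) : σ • (⊤ : Y.Face) = ⊤ :=
  Subtype.ext (Y.map_cone σ)

/-- `σ` fixes the face `F` pointwise. -/
def Fixes (σ : D.W) (F : Y.Face) : Prop := ∀ lam ∈ F.1, σ.1 lam = lam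

/-- The cross section: the faces whose relative interior meets the closed chamber. -/
def crossSection : Set Y.Face :=
  {F | (intrinsicInterior ℝ (F.1 : Set (StrongDual ℝ V)) ∩
    (D.chamber : Set (StrongDual ℝ V))).Nonempty}

/-- The type map `υ`. -/
def typeMap (F : Y.crossSection) : Set ι := {i | D.simple i • F.1 = F.1}

/-- The lower type map `υ_*`. -/
def lowerTypeMap (F : Y.crossSection) : Set ι := {i | Y.Fixes (D.simple i) F.1}

/-- The upper type map `υ^*`. -/
def upperTypeMap (F : Y.crossSection) : Set ι := Y.typeMap F \ Y.lowerTypeMap F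

/-! #### The monoid `R(Y)` -/

/-- The underlying set of the semidirect product of the group with the face lattice. -/
@[ext]
structure Semidirect where
  elt : D.W
  face : Y.Face

/-- `(σ, R) * (τ, T) = (σ τ, τ⁻¹ R ∩ T)`, with unit `(1, Y)`. -/
noncomputable instance : Monoid Y.Semidirect where
  mul x y := ⟨x.elt * y.elt, y.elt⁻¹ • x.face ⊓ y.face⟩
  one := ⟨1, ⊤⟩
  mul_assoc x y z := by
    apply Semidirect.ext
    · exact mul_assoc _ _ _
    · change z.elt⁻¹ • (y.elt⁻¹ • x.face ⊓ y.face) ⊓ z.face =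
        (y.elt * z.elt)⁻¹ • x.face ⊓ (z.elt⁻¹ • y.face ⊓ z.face)
      rw [smul_inf, mul_inv_rev, mul_smul, inf_assoc]
  one_mul x := by
    apply Semidirect.ext
    · exact one_mul _
    · change x.elt⁻¹ • (⊤ : Y.Face) ⊓ x.face = x.face
      rw [smul_top, top_inf_eq]
  mul_one x := by
    apply Semidirect.ext
    · exact mul_one _
    · change (1 : D.W)⁻¹ • x.face ⊓ ⊤ = x.face
      rw [inv_one, one_smul, inf_top_eq]

/-- `(σ, R) ~ (σ', R')` iff `R = R'` and `σ⁻¹ σ'` fixes `R` pointwise. -/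
noncomputable def rennerCon : Con Y.Semidirect where
  r x y := x.face = y.face ∧ Y.Fixes (x.elt⁻¹ * y.elt) x.face
  iseqv :=
    { refl := fun x => ⟨rfl, fun lam _ => by rw [inv_mul_cancel]; rfl⟩
      symm := by
        rintro ⟨σ, R⟩ ⟨σ', R'⟩ ⟨h₁, h₂⟩
        change R = R' at h₁
        subst h₁
        refine ⟨rfl, fun lam hl => ?_⟩
        have h := h₂ lam hl
        change σ.1.symm (σ'.1 lam) = lam at h
        change σ'.1.symm (σ.1 lam) = lam
        rw [LinearEquiv.symm_apply_eq] at h ⊢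
        exact h.symm
      trans := by
        rintro ⟨σ, R⟩ ⟨σ', R'⟩ ⟨σ'', R''⟩ ⟨h₁, h₂⟩ ⟨h₃, h₄⟩
        change R = R' at h₁
        change R' = R'' at h₃
        subst h₁
        subst h₃
        refine ⟨rfl, fun lam hl => ?_⟩
        have h := h₂ lam hl
        have h' := h₄ lam hl
        change σ.1.symm (σ'.1 lam) = lam at h
        change σ'.1.symm (σ''.1 lam) = lam at h'
        change σ.1.symm (σ''.1 lam) = lam
        rw [LinearEquiv.symm_apply_eq] at h h' ⊢
        rw [h', h] }
  mul' := by
    rintro ⟨σ, R⟩ ⟨σ', R'⟩ ⟨τ, T⟩ ⟨τ', T'⟩ ⟨h₁, h₂⟩ ⟨h₃, h₄⟩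
    change R = R' at h₁
    change T = T' at h₃
    subst h₁
    subst h₃
    have key : ∀ lam ∈ T.1, τ'.1 lam = τ.1 lam := by
      intro lam hl
      have h := h₄ lam hl
      change τ.1.symm (τ'.1 lam) = lam at h
      rwa [LinearEquiv.symm_apply_eq] at h
    refine ⟨?_, ?_⟩
    · change τ⁻¹ • R ⊓ T = τ'⁻¹ • R ⊓ T
      apply Subtype.ext
      ext lam
      simp only [FaceLattice.coe_inf, Submodule.mem_inf, mem_smul_iff, inv_inv]
      constructor
      · rintro ⟨ha, hb⟩
        exact ⟨by rwa [key lam hb], hb⟩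
      · rintro ⟨ha, hb⟩
        exact ⟨by rwa [← key lam hb], hb⟩
    · intro lam hl
      change lam ∈ (τ⁻¹ • R ⊓ T : Y.Face).1 at hl
      rw [FaceLattice.coe_inf, Submodule.mem_inf, mem_smul_iff, inv_inv] at hl
      have h := h₂ _ hl.1
      change σ.1.symm (σ'.1 (τ.1 lam)) = τ.1 lam at h
      rw [LinearEquiv.symm_apply_eq] at h
      change (σ.1 * τ.1).symm (σ'.1 (τ'.1 lam)) = lam
      rw [LinearEquiv.symm_apply_eq, key lam hl.2, h]
      rfl

/-- The monoid `R(Y)`. -/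
abbrev RennerMonoid : Type _ := Y.rennerCon.Quotient

/-- The class of `(σ, R)` in `R(Y)`. -/
noncomputable def bracket (σ : D.W) (R : Y.Face) : Y.RennerMonoid :=
  ((⟨σ, R⟩ : Y.Semidirect) : Y.rennerCon.Quotient)

end InvariantSubcone

/-! ### Regular type maps -/

section RegularTypeMap

variable {ι G U : Type*} [Group G]

/-- The standard parabolic subgroup generated by the `s j`, `j ∈ J`. -/
def standardParabolic (s : ι → G) (J : Set ι) : Subgroup G := Subgroup.closure (s '' J)

/-- The set `F(U, lam)` of all pairs `(u, σ W_{lam(u)})`. -/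
def TypeMapPairs (s : ι → G) (lam : U → Set ι) : Type _ :=
  Σ u : U, G ⧸ standardParabolic s (lam u)

/-- The pair `(u, σ W_{lam(u)})`. -/
def TypeMapPairs.mk (s : ι → G) (lam : U → Set ι) (u : U) (σ : G) : TypeMapPairs s lam :=
  ⟨u, (σ : G ⧸ standardParabolic s (lam u))⟩

/-- `(u₁, σ₁ W_{lam(u₁)}) ≤ (u₂, σ₂ W_{lam(u₂)})` iff `u₁ ≤ u₂` and the two cosets intersect. -/
instance TypeMapPairs.instLE [LE U] (s : ι → G) (lam : U → Set ι) : LE (TypeMapPairs s lam) where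
  le x y := x.1 ≤ y.1 ∧ ∃ g : G, (g : G ⧸ standardParabolic s (lam x.1)) = x.2 ∧
    (g : G ⧸ standardParabolic s (lam y.1)) = y.2

/-- `U` is a lower semilattice with biggest element `1`, `lam(1) = I`, and `F(U, lam)` is a lower
semilattice with biggest element `(1, W)`. -/
structure IsRegularTypeMap [PartialOrder U] (s : ι → G) (lam : U → Set ι) : Prop where
  exists_glb : ∀ u v : U, ∃ w, IsGLB {u, v} w
  exists_top : ∃ one : U, (∀ u, u ≤ one) ∧ lam one = Set.univ ∧
    ∀ x : TypeMapPairs s lam, x ≤ TypeMapPairs.mk s lam one 1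
  refl : ∀ x : TypeMapPairs s lam, x ≤ x
  antisymm : ∀ x y : TypeMapPairs s lam, x ≤ y → y ≤ x → x = y
  trans : ∀ x y z : TypeMapPairs s lam, x ≤ y → y ≤ z → x ≤ z
  exists_meet : ∀ x y : TypeMapPairs s lam,
    ∃ z, z ≤ x ∧ z ≤ y ∧ ∀ w, w ≤ x → w ≤ y → w ≤ z

end RegularTypeMap

/-! ### Generalized Renner–Coxeter systems -/

section RennerCoxeter

variable {M : Type*} [Monoid M]

/-- The partial order on idempotents: `e ≤ f` iff `e f = f e = e`. -/
def IdemLE (e f : M) : Prop := e * f = e ∧ f * e = e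

/-- The idempotents form a commutative submonoid, and every element is a product of a unit and an
idempotent in either order. -/
structure IsFactorisable (M : Type*) [Monoid M] : Prop where
  idem_mul : ∀ e f : M, IsIdempotentElem e → IsIdempotentElem f → IsIdempotentElem (e * f)
  idem_comm : ∀ e f : M, IsIdempotentElem e → IsIdempotentElem f → e * f = f * e
  unit_mul_idem : ∀ x : M, ∃ u : Mˣ, ∃ e : M, IsIdempotentElem e ∧ x = u * e
  idem_mul_unit : ∀ x : M, ∃ e : M, ∃ u : Mˣ, IsIdempotentElem e ∧ x = e * u

/-- The type map of `(M, Λ, S)`: all `s ∈ S` with `s e = e s`. -/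
def rennerType (S : Set Mˣ) (e : M) : Set Mˣ := {s ∈ S | (s : M) * e = e * s}

/-- The lower type map: all `s ∈ S` with `s e = e s = e`. -/
def rennerLowerType (S : Set Mˣ) (e : M) : Set Mˣ :=
  {s ∈ S | (s : M) * e = e * s ∧ e * (s : M) = e}

/-- The upper type map: all `s ∈ S` with `s e = e s ≠ e`. -/
def rennerUpperType (S : Set Mˣ) (e : M) : Set Mˣ :=
  {s ∈ S | (s : M) * e = e * s ∧ e * (s : M) ≠ e}

/-- `(M, Λ, S)` is a generalized Renner–Coxeter system. -/
structure IsGeneralizedRennerCoxeterSystem (M : Type*) [Monoid M] (Λ : Set M) (S : Set Mˣ) :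
    Prop where
  factorisable : IsFactorisable M
  coxeter : ∃ (m : CoxeterMatrix S) (cs : CoxeterSystem m Mˣ), ∀ s : S, cs.simple s = s
  idem : ∀ e ∈ Λ, IsIdempotentElem e
  mul_mem : ∀ e ∈ Λ, ∀ f ∈ Λ, e * f ∈ Λ
  cross_section : ∀ e : M, IsIdempotentElem e →
    ∃! f : M, f ∈ Λ ∧ ∃ x : Mˣ, e = x * f * (x⁻¹ : Mˣ)
  pairs : ∀ e₁ e₂ : M, IsIdempotentElem e₁ → IsIdempotentElem e₂ → IdemLE e₁ e₂ →
    ∃ x : Mˣ, ∃ f₁ ∈ Λ, ∃ f₂ ∈ Λ, IdemLE f₁ f₂ ∧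
      e₁ = x * f₁ * (x⁻¹ : Mˣ) ∧ e₂ = x * f₂ * (x⁻¹ : Mˣ)
  centralizer_parabolic : ∀ e ∈ Λ, ∃ J ⊆ S,
    (Subgroup.closure J : Set Mˣ) = {x : Mˣ | (x : M) * e = e * x}
  stabilizer_parabolic : ∀ e ∈ Λ, ∃ J ⊆ S,
    (Subgroup.closure J : Set Mˣ) = {x : Mˣ | (x : M) * e = e * x ∧ e * (x : M) = e}
  upper_monotone : ∀ e ∈ Λ, ∀ f ∈ Λ, IdemLE e f → rennerUpperType S e ⊆ rennerUpperType S f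

end RennerCoxeter

/-! Everything rests on the chamber geometry of 𝒲 and on moving points of relative interiors into
the closed chamber. "σC lies beyond the wall i of C" is a descent relation
(`LinearCoxeterSystem.descentRelation`). From it come the exchange condition, Matsumoto's theorem
and hence the Coxeter presentation, and also an induction on σ along descents. That induction shows
that the closed chamber is a fundamental domain with parabolic point stabilizers
(`eq_and_mem_standardParabolic`), and that a short segment from a chamber point p into the Tits cone
can be moved into the closed chamber by an element of the stabilizer of p
(`exists_add_smul_mem_chamber`).

A face is determined by any of its relative interior points, so these facts pass to faces. If a
segment between two interior points of F leaves the closed chamber through the wall i, the exit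
point is interior to F and fixed by σ_i, so σ_i stabilizes F. Therefore Υ meets each orbit of faces
once, with parabolic stabilizers (`eq_and_mem_of_smul_eq`). A generic point of a face in Υ gives the
pointwise stabilizers (`exists_generic_point`, `fixes_iff`) and the monotonicity of υ^*
(`upper_type_mono`).

A chain is moved into Υ one face at a time: the next correction fixes interior points already placed
in the chamber (`exists_smul_chain`). For two faces this turns σR ⊆ τT into R ⊆ T together with a
common representative g (`exists_common_smul`). From this follow closure of Υ under meets and the
description of Fa(Y) by cosets. Joins come from adding interior points, and strict growth of spans
reduces arbitrary families to binary operations. Idempotents of the monoid are faces and, under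
faithfulness, its units are 𝒲, so the Renner–Coxeter axioms restate these results. -/

/-! ### Coxeter presentations from a descent relation -/

section DescentRelation

variable {ι W G : Type*} [Group W] [Group G]

/-- The product of the word `ω` in the generators `s`. -/
def wordProduct (s : ι → G) (ω : List ι) : G := (ω.map s).prod

@[simp] theorem wordProduct_nil (s : ι → G) : wordProduct s [] = 1 := rfl

@[simp] theorem wordProduct_cons (s : ι → G) (i : ι) (ω : List ι) :
    wordProduct s (i :: ω) = s i * wordProduct s ω := by
  simp [wordProduct]

@[simp] theorem wordProduct_append (s : ι → G) (ω ω' : List ι) :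
    wordProduct s (ω ++ ω') = wordProduct s ω * wordProduct s ω' := by
  simp [wordProduct]

theorem exists_wordProduct_eq {s : ι → G} (hs : ∀ i, s i * s i = 1)
    (hgen : Subgroup.closure (Set.range s) = ⊤) (w : G) : ∃ ω, wordProduct s ω = w := by
  have hw : w ∈ Subgroup.closure (Set.range s) := hgen ▸ Subgroup.mem_top w
  induction hw using Subgroup.closure_induction_left with
  | one => exact ⟨[], rfl⟩
  | mul_left x hx y _ ih =>
    obtain ⟨i, rfl⟩ := hx
    obtain ⟨ω, rfl⟩ := ih
    exact ⟨i :: ω, by simp⟩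
  | inv_mul_cancel x hx y _ ih =>
    obtain ⟨i, rfl⟩ := hx
    obtain ⟨ω, rfl⟩ := ih
    exact ⟨i :: ω, by rw [wordProduct_cons, inv_eq_of_mul_eq_one_left (hs i)]⟩

/-- The alternating word `i, j, i, …` of length `k`. -/
def alternatingList (i j : ι) : ℕ → List ι
  | 0 => []
  | k + 1 => i :: alternatingList j i k

theorem length_alternatingList (i j : ι) (k : ℕ) : (alternatingList i j k).length = k := by
  induction k generalizing i j with
  | zero => rfl
  | succ k ih => simp [alternatingList, ih]

theorem take_alternatingList (i j : ι) {p k : ℕ} (h : p ≤ k) :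
    (alternatingList i j k).take p = alternatingList i j p := by
  induction k generalizing i j p with
  | zero => obtain rfl : p = 0 := by omega
            rfl
  | succ k ih =>
    cases p with
    | zero => rfl
    | succ p => simp [alternatingList, ih j i (Nat.le_of_succ_le_succ h)]

theorem wordProduct_alternatingList_mul_inv {s : ι → G} (hs : ∀ i, s i * s i = 1) (i j : ι)
    (k : ℕ) :
    wordProduct s (alternatingList i j k) * (wordProduct s (alternatingList j i k))⁻¹ =
      (s i * s j) ^ k := by
  induction k generalizing i j with
  | zero => simp [alternatingList]
  | succ k ih =>
    have hj : (s j)⁻¹ = s j := inv_eq_of_mul_eq_one_left (hs j)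
    have h := ih j i
    simp only [alternatingList, wordProduct_cons, mul_inv_rev, hj]
    calc s i * wordProduct s (alternatingList j i k) *
          ((wordProduct s (alternatingList i j k))⁻¹ * s j)
        = s i * (wordProduct s (alternatingList j i k) *
          (wordProduct s (alternatingList i j k))⁻¹) * s j := by group
      _ = (s i * s j) ^ (k + 1) := by
        rw [h, ← mul_pow_mul, mul_assoc, pow_succ]

theorem wordProduct_alternatingList_eq_iff {s : ι → G} (hs : ∀ i, s i * s i = 1) (i j : ι)
    (k : ℕ) :
    wordProduct s (alternatingList i j k) = wordProduct s (alternatingList j i k) ↔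
      (s i * s j) ^ k = 1 := by
  rw [← wordProduct_alternatingList_mul_inv hs, mul_inv_eq_one]

/-- An abstract form of the relation "the chambers `w C` and `C` lie on different sides of the
wall `i` of `C`" for a group generated by the reflections `s` in the walls of `C`. -/
structure DescentRelation (s : ι → W) (N : W → ι → Prop) : Prop where
  sq : ∀ i, s i * s i = 1
  closure_eq_top : Subgroup.closure (Set.range s) = ⊤
  not_one : ∀ i, ¬ N 1 i
  simple_mul : ∀ w i, N (s i * w) i ↔ ¬ N w i
  fold : ∀ u i j, ¬ N u i → N (u * s j) i → s i * u = u * s j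

/-- A word is reduced if no shorter word has the same product. -/
def IsReducedWord (s : ι → W) (ω : List ι) : Prop :=
  ∀ ω', wordProduct s ω' = wordProduct s ω → ω.length ≤ ω'.length

theorem IsReducedWord.tail {s : ι → W} {i : ι} {ω : List ι} (h : IsReducedWord s (i :: ω)) :
    IsReducedWord s ω := by
  intro ω' hω'
  have := h (i :: ω') (by simp [hω'])
  simpa using this

/-! ### Exchange condition, Matsumoto's theorem, Coxeter presentation -/

namespace DescentRelation

variable {s : ι → W} {N : W → ι → Prop}

/-- The prefixes of ω form a gallery starting at C, which is not beyond the wall i. At the first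
prefix that is beyond it, the gallery crosses that wall, and `fold` identifies the two reflections
there. -/
theorem exchange (h : DescentRelation s N) {ω : List ι} {i : ι} (hN : N (wordProduct s ω) i) :
    ∃ p < ω.length, s i * wordProduct s (ω.take p) = wordProduct s (ω.take (p + 1)) := by
  classical
  have hex : ∃ p, N (wordProduct s (ω.take p)) i := ⟨ω.length, by simpa using hN⟩
  obtain ⟨q, hq⟩ : ∃ q, Nat.find hex = q + 1 := by
    refine Nat.exists_eq_succ_of_ne_zero fun h0 => ?_
    have := Nat.find_spec hex
    rw [h0] at this
    exact h.not_one i this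
  have h1 : N (wordProduct s (ω.take (q + 1))) i := hq ▸ Nat.find_spec hex
  have h2 : ¬ N (wordProduct s (ω.take q)) i := Nat.find_min hex (by omega)
  have hlt : q < ω.length := by
    by_contra hle
    rw [List.take_of_length_le (by omega)] at h1 h2
    exact h2 h1
  refine ⟨q, hlt, ?_⟩
  have ht : ω.take (q + 1) = ω.take q ++ [ω[q]] := by simp
  rw [ht, wordProduct_append] at h1 ⊢
  simpa using h.fold _ i ω[q] h2 (by simpa using h1)

theorem simple_mul_cancel (h : DescentRelation s N) (i : ι) (w : W) : s i * (s i * w) = w := by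
  rw [← mul_assoc, h.sq, one_mul]

theorem exchange_eq {ω : List ι} {i : ι} {p : ℕ}
    (hp : s i * wordProduct s (ω.take p) = wordProduct s (ω.take (p + 1))) :
    wordProduct s ω = s i * wordProduct s (ω.take p ++ ω.drop (p + 1)) := by
  conv_lhs => rw [← List.take_append_drop (p + 1) ω, wordProduct_append, ← hp]
  rw [wordProduct_append, mul_assoc]

theorem exists_shorter (h : DescentRelation s N) {ω : List ι} {i : ι} (hN : N (wordProduct s ω) i) :
    ∃ ω' : List ι, ω'.length + 1 = ω.length ∧ wordProduct s ω = s i * wordProduct s ω' := by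
  obtain ⟨p, hp, he⟩ := h.exchange hN
  refine ⟨_, ?_, exchange_eq he⟩
  simp
  omega

/-- Induction along descents. -/
theorem induction (h : DescentRelation s N) {P : W → Prop}
    (hP : ∀ w, (∀ i, N w i → P (s i * w)) → P w) (w : W) : P w := by
  obtain ⟨ω, rfl⟩ := exists_wordProduct_eq h.sq h.closure_eq_top w
  induction hn : ω.length using Nat.strong_induction_on generalizing ω with
  | _ n ih =>
    refine hP _ fun i hi => ?_
    obtain ⟨ω', hl, he⟩ := h.exists_shorter hi
    rw [he, h.simple_mul_cancel]
    exact ih _ (by omega) ω' rfl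

theorem descent_of_isReducedWord_cons (h : DescentRelation s N) {i : ι} {ω : List ι}
    (hr : IsReducedWord s (i :: ω)) : N (wordProduct s (i :: ω)) i := by
  rw [wordProduct_cons, h.simple_mul]
  intro hN
  obtain ⟨ω', hl, he⟩ := h.exists_shorter hN
  have := hr ω' (by rw [wordProduct_cons, he, h.simple_mul_cancel])
  simp at this
  omega

/-- Left multiplication by s_i creates a descent at i. Any word for the product can therefore be
shortened to a word for the original element, which bounds its length from below. -/
theorem isReducedWord_cons (h : DescentRelation s N) {i : ι} {ω : List ι} (hr : IsReducedWord s ω)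
    (hN : ¬ N (wordProduct s ω) i) : IsReducedWord s (i :: ω) := by
  intro ρ hρ
  rw [wordProduct_cons] at hρ
  have : N (wordProduct s ρ) i := by rwa [hρ, h.simple_mul]
  obtain ⟨ω', hl, he⟩ := h.exists_shorter this
  have := hr ω' (by rw [he] at hρ; exact mul_left_cancel hρ)
  simp
  omega

theorem isReducedWord_of_length_le {ω ω' : List ι} (hr : IsReducedWord s ω)
    (he : wordProduct s ω' = wordProduct s ω) (hl : ω'.length ≤ ω.length) :
    IsReducedWord s ω' := fun ρ hρ => hl.trans (hr ρ (hρ.trans he))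

/-- Matsumoto's theorem: all reduced words of an element have the same product in every group in
which the braid relations hold. -/
theorem wordProduct_eq_of_isReducedWord (h : DescentRelation s N) {f : ι → G}
    (hf : ∀ i, f i * f i = 1)
    (hfs : ∀ i j k, (s i * s j) ^ k = 1 → (f i * f j) ^ k = 1) {ω ω' : List ι}
    (hr : IsReducedWord s ω) (hr' : IsReducedWord s ω')
    (he : wordProduct s ω = wordProduct s ω') : wordProduct f ω = wordProduct f ω' := by
  induction hn : ω.length generalizing ω ω' with
  | zero =>
    obtain rfl := List.length_eq_zero_iff.1 hn
    have := hr' [] he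
    obtain rfl : ω' = [] := List.length_eq_zero_iff.1 (by simpa using this)
    rfl
  | succ n ih =>
    have hn' : ω'.length = n + 1 := le_antisymm (hn ▸ hr' _ he) (hn ▸ hr _ he.symm)
    have first : ∀ (i : ι) (a b : List ι), IsReducedWord s (i :: a) → IsReducedWord s (i :: b) →
        wordProduct s (i :: a) = wordProduct s (i :: b) → (i :: a).length = n + 1 →
        wordProduct f (i :: a) = wordProduct f (i :: b) := by
      intro i a b ha hb hab hl
      rw [wordProduct_cons, wordProduct_cons, ih ha.tail hb.tail (by simpa using hab)
        (by simpa using hl)]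
    -- Unless the two images already agree, the common element has a word of length n + 1 starting
    -- with arbitrarily many alternating letters i, j; this must fail once k exceeds n + 1.
    have key : ∀ (k : ℕ) (i j : ι) (a b : List ι), IsReducedWord s (i :: a) →
        IsReducedWord s (j :: b) → wordProduct s (i :: a) = wordProduct s (j :: b) →
        (i :: a).length = n + 1 → (j :: b).length = n + 1 →
        wordProduct f (i :: a) = wordProduct f (j :: b) ∨
        ∃ ρ, wordProduct s (alternatingList i j k ++ ρ) = wordProduct s (i :: a) ∧
          (alternatingList i j k ++ ρ).length = n + 1 := by
      intro k
      induction k with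
      | zero => exact fun i j a b _ _ _ hl _ => Or.inr ⟨i :: a, rfl, hl⟩
      | succ k ihk =>
        intro i j a b ha hb hab hla hlb
        rcases ihk j i b a hb ha hab.symm hlb hla with hd | ⟨ρ, hρ, hρl⟩
        · exact Or.inl hd.symm
        set τ := alternatingList j i k ++ ρ with hτ
        have hτr : IsReducedWord s τ := isReducedWord_of_length_le hb hρ (by omega)
        have hN : N (wordProduct s τ) i := by
          rw [hρ, ← hab]
          exact h.descent_of_isReducedWord_cons ha
        obtain ⟨p, hp, hpe⟩ := h.exchange hN
        have hlen := length_alternatingList j i k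
        rcases le_or_gt k p with hkp | hkp
        -- The exchange deletes a letter of ρ, so putting i in front lengthens the alternating
        -- prefix.
        · refine Or.inr ⟨ρ.take (p - k) ++ ρ.drop (p + 1 - k), ?_, ?_⟩
          · have h1 := exchange_eq hpe
            rw [hρ, ← hab, hτ, List.take_append, List.drop_append, hlen,
              List.take_of_length_le (by omega), List.drop_of_length_le (by omega)] at h1
            rw [h1]
            simp [alternatingList]
          · rw [hτ, List.length_append, hlen] at hp hρl
            simp [alternatingList, length_alternatingList]
            omega
        -- The exchange happens inside the alternating prefix and is then a braid relation of length
        -- p + 1, which also holds for f.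
        · have ht : ∀ q ≤ k, τ.take q = alternatingList j i q := by
            intro q hq
            rw [hτ, List.take_append_of_le_length (by omega), take_alternatingList _ _ hq]
          rw [ht p hkp.le, ht (p + 1) hkp] at hpe
          have hbr : wordProduct s (alternatingList i j (p + 1)) =
              wordProduct s (alternatingList j i (p + 1)) := by
            rw [← hpe]
            simp [alternatingList]
          have hbf := (wordProduct_alternatingList_eq_iff hf i j (p + 1)).2
            (hfs _ _ _ ((wordProduct_alternatingList_eq_iff h.sq i j (p + 1)).1 hbr))
          have hsplit : τ = alternatingList j i (p + 1) ++ τ.drop (p + 1) := by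
            rw [← ht (p + 1) hkp, List.take_append_drop]
          have hσ : wordProduct s (alternatingList i j (p + 1) ++ τ.drop (p + 1)) =
              wordProduct s τ := by
            conv_rhs => rw [hsplit]
            rw [wordProduct_append, wordProduct_append, hbr]
          have hσf : wordProduct f (alternatingList i j (p + 1) ++ τ.drop (p + 1)) =
              wordProduct f τ := by
            conv_rhs => rw [hsplit]
            rw [wordProduct_append, wordProduct_append, hbf]
          have hσl : (alternatingList i j (p + 1) ++ τ.drop (p + 1)).length = τ.length := by
            simp [length_alternatingList]
            omega
          have hσr := isReducedWord_of_length_le hτr hσ hσl.le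
          -- Swapping the braid prefix turns τ, which starts with j, into a word starting with i.
          -- Each of the two given words can now be compared with one that has the same first
          -- letter.
          refine Or.inl ?_
          rw [first i a (alternatingList j i p ++ τ.drop (p + 1)) ha hσr
            (by rw [hab, ← hρ, ← hσ]; rfl) hla]
          refine Eq.trans hσf ?_
          have h2 : τ = j :: (alternatingList i j p ++ τ.drop (p + 1)) := hsplit
          rw [h2]
          refine first j _ _ (h2 ▸ hτr) hb (by rw [← h2, hρ]) (by rw [← h2, hρl])
    obtain ⟨i, a, rfl⟩ := List.exists_cons_of_length_eq_add_one hn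
    obtain ⟨j, b, rfl⟩ := List.exists_cons_of_length_eq_add_one hn'
    rcases key (n + 2) i j a b hr hr' he hn hn' with hd | ⟨ρ, -, hl⟩
    · exact hd
    · rw [List.length_append, length_alternatingList] at hl
      omega

theorem exists_isReducedWord (h : DescentRelation s N) {f : ι → G} (hf : ∀ i, f i * f i = 1)
    (hfs : ∀ i j k, (s i * s j) ^ k = 1 → (f i * f j) ^ k = 1) (ω : List ι) :
    ∃ ω', IsReducedWord s ω' ∧ wordProduct s ω' = wordProduct s ω ∧
      wordProduct f ω' = wordProduct f ω := by
  induction ω with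
  | nil => exact ⟨[], fun ω' _ => Nat.zero_le _, rfl, rfl⟩
  | cons i τ ih =>
    obtain ⟨τ', hr, hs, hf'⟩ := ih
    by_cases hN : N (wordProduct s τ') i
    · obtain ⟨τ'', hl, he⟩ := h.exists_shorter hN
      have hr' : IsReducedWord s (i :: τ'') :=
        isReducedWord_of_length_le hr (by rw [he, wordProduct_cons]) (by simp; omega)
      have hp := h.wordProduct_eq_of_isReducedWord hf hfs hr hr' (by rw [he, wordProduct_cons])
      refine ⟨τ'', hr'.tail, ?_, ?_⟩
      · rw [wordProduct_cons, ← hs, he, h.simple_mul_cancel]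
      · rw [wordProduct_cons, ← hf', hp, wordProduct_cons, ← mul_assoc, hf, one_mul]
    · exact ⟨i :: τ', h.isReducedWord_cons hr hN, by simp [hs], by simp [hf']⟩

/-- The Coxeter matrix of the orders of the products of two generators. -/
noncomputable def coxeterMatrix (h : DescentRelation s N) (hinj : Function.Injective s) :
    CoxeterMatrix ι where
  -- An infinite order gives the entry 0, which encodes the absence of a relation.
  M := Matrix.of fun i j => orderOf (s i * s j)
  isSymm := by
    ext i j
    have : s j * s i = (s i * s j)⁻¹ := by
      rw [mul_inv_rev, inv_eq_of_mul_eq_one_left (h.sq i), inv_eq_of_mul_eq_one_left (h.sq j)]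
    rw [Matrix.transpose_apply, Matrix.of_apply, Matrix.of_apply, this, orderOf_inv]
  diagonal i := by rw [Matrix.of_apply, h.sq, orderOf_one]
  off_diagonal i j hij h1 := hij (hinj (by
    rw [Matrix.of_apply, orderOf_eq_one_iff] at h1
    exact mul_right_cancel (h1.trans (h.sq j).symm)))

theorem lift_bijective (h : DescentRelation s N) (hinj : Function.Injective s)
    (hl : (h.coxeterMatrix hinj).IsLiftable s) :
    Function.Bijective ((h.coxeterMatrix hinj).toCoxeterSystem.lift ⟨s, hl⟩) := by
  set M := h.coxeterMatrix hinj with hM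
  have hprod : ∀ ω, M.toCoxeterSystem.lift ⟨s, hl⟩ (wordProduct M.toCoxeterSystem.simple ω) =
      wordProduct s ω := by
    intro ω
    induction ω with
    | nil => simp
    | cons i ω ih => rw [wordProduct_cons, wordProduct_cons, map_mul, ih,
        CoxeterSystem.lift_apply_simple]
  constructor
  · rw [injective_iff_map_eq_one]
    intro g hg
    have hf : ∀ i, M.toCoxeterSystem.simple i * M.toCoxeterSystem.simple i = 1 :=
      M.toCoxeterSystem.simple_mul_simple_self
    have hfs : ∀ i j k, (s i * s j) ^ k = 1 →
        (M.toCoxeterSystem.simple i * M.toCoxeterSystem.simple j) ^ k = 1 := by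
      intro i j k hk
      obtain ⟨m, rfl⟩ := orderOf_dvd_of_pow_eq_one hk
      have : (M.toCoxeterSystem.simple i * M.toCoxeterSystem.simple j) ^ orderOf (s i * s j) = 1 :=
        M.toCoxeterSystem.simple_mul_simple_pow i j
      rw [pow_mul, this, one_pow]
    obtain ⟨ω, rfl⟩ := exists_wordProduct_eq hf
      M.toCoxeterSystem.subgroup_closure_range_simple g
    rw [hprod] at hg
    -- Passing to a reduced word keeps the products in both groups, and the only reduced word of 1
    -- is empty.
    obtain ⟨ω', hr, hs, hf'⟩ := h.exists_isReducedWord hf hfs ω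
    have := hr [] (by rw [hs, hg, wordProduct_nil])
    obtain rfl : ω' = [] := List.length_eq_zero_iff.1 (by simpa using this)
    rw [← hf', wordProduct_nil]
  · intro w
    obtain ⟨ω, rfl⟩ := exists_wordProduct_eq h.sq h.closure_eq_top w
    exact ⟨_, hprod ω⟩

/-- A group with a descent relation is a Coxeter group. -/
theorem exists_coxeterSystem (h : DescentRelation s N) (hinj : Function.Injective s) :
    ∃ (m : CoxeterMatrix ι) (cs : CoxeterSystem m W), ∀ i, cs.simple i = s i := by
  have hl : (h.coxeterMatrix hinj).IsLiftable s := fun i j => pow_orderOf_eq_one (s i * s j)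
  refine ⟨h.coxeterMatrix hinj, (h.coxeterMatrix hinj).toCoxeterSystem.map
    (MulEquiv.ofBijective _ (h.lift_bijective hinj hl)), fun i => ?_⟩
  rw [CoxeterSystem.map_simple, MulEquiv.ofBijective_apply, CoxeterSystem.lift_apply_simple]

end DescentRelation

end DescentRelation

/-! ### The chamber system of a linear Coxeter system -/

namespace LinearCoxeterSystem

open Filter Topology

variable {ι V : Type*} [NormedAddCommGroup V] [NormedSpace ℝ V] (D : LinearCoxeterSystem ι V)

theorem simple_apply (i : ι) (lam : StrongDual ℝ V) :
    (D.simple i).1 lam = lam - lam (D.h i) • D.α i := rfl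

theorem mul_apply (σ τ : D.W) (lam : StrongDual ℝ V) : (σ * τ).1 lam = σ.1 (τ.1 lam) := rfl

theorem one_apply (lam : StrongDual ℝ V) : (1 : D.W).1 lam = lam := rfl

theorem inv_apply_self (σ : D.W) (lam : StrongDual ℝ V) : σ⁻¹.1 (σ.1 lam) = lam :=
  LinearEquiv.symm_apply_apply σ.1 lam

theorem apply_inv_self (σ : D.W) (lam : StrongDual ℝ V) : σ.1 (σ⁻¹.1 lam) = lam :=
  LinearEquiv.apply_symm_apply σ.1 lam

theorem ext_apply {σ τ : D.W} (h : ∀ lam, σ.1 lam = τ.1 lam) : σ = τ :=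
  Subtype.ext (LinearEquiv.ext h)

theorem simple_apply_h (i : ι) (lam : StrongDual ℝ V) :
    (D.simple i).1 lam (D.h i) = - lam (D.h i) := by
  simp only [simple_apply, sub_apply, smul_apply, D.pairing, smul_eq_mul]
  ring

theorem simple_apply_eq_self {i : ι} {lam : StrongDual ℝ V} (h : lam (D.h i) = 0) :
    (D.simple i).1 lam = lam := by
  rw [simple_apply, h, zero_smul, sub_zero]

theorem simple_apply_eq_self_iff {i : ι} {lam : StrongDual ℝ V} :
    (D.simple i).1 lam = lam ↔ lam (D.h i) = 0 := by
  refine ⟨fun h => ?_, D.simple_apply_eq_self⟩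
  have := D.simple_apply_h i lam
  rw [h] at this
  linarith

theorem simple_mul_self (i : ι) : D.simple i * D.simple i = 1 := by
  refine D.ext_apply fun lam => ?_
  rw [mul_apply, one_apply, D.simple_apply i ((D.simple i).1 lam), simple_apply_h, simple_apply]
  ext v
  simp only [sub_apply, smul_apply, smul_eq_mul]
  ring

theorem simple_inv (i : ι) : (D.simple i)⁻¹ = D.simple i :=
  inv_eq_of_mul_eq_one_left (D.simple_mul_self i)

theorem simple_simple_apply (i : ι) (lam : StrongDual ℝ V) :
    (D.simple i).1 ((D.simple i).1 lam) = lam := by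
  rw [← mul_apply, simple_mul_self, one_apply]

theorem closure_range_simple : Subgroup.closure (Set.range D.simple) = ⊤ := by
  have h : Set.range D.simple = (↑) ⁻¹'
      (Set.range fun i => dualReflection (D.h i) (D.α i) (D.pairing i)) := by
    ext σ
    constructor
    · rintro ⟨i, rfl⟩
      exact ⟨i, rfl⟩
    · rintro ⟨i, hi⟩
      exact ⟨i, Subtype.ext hi⟩
  rw [h]
  exact Subgroup.closure_closure_coe_preimage

theorem mem_chamber {lam : StrongDual ℝ V} : lam ∈ D.chamber ↔ ∀ i, 0 ≤ lam (D.h i) := Iff.rfl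

theorem eq_one_of_mem_openChamber {σ : D.W} {lam : StrongDual ℝ V} (h : lam ∈ openChamber D.h)
    (h' : σ.1 lam ∈ openChamber D.h) : σ = 1 := by
  by_contra hσ
  refine Set.disjoint_left.1 (D.disjoint_chamber σ.1 σ.2 fun h1 => hσ (Subtype.ext h1))
    ⟨lam, h, rfl⟩ h'

theorem simple_ne_one (i : ι) : D.simple i ≠ 1 := by
  intro h
  have h1 := D.simple_apply_h i (D.α i)
  rw [h, one_apply, D.pairing] at h1
  norm_num at h1

/-! ### Interior points of the chamber and of its walls -/

theorem exists_pos_on [Finite ι] {K : PointedCone ℝ (StrongDual ℝ V)} (hK : K ≤ D.chamber)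
    {J : Set ι} (h : ∀ i ∈ J, ∃ lam ∈ K, 0 < lam (D.h i)) :
    ∃ lam ∈ K, ∀ i ∈ J, 0 < lam (D.h i) := by
  classical
  have := Fintype.ofFinite ι
  have h' : ∀ i, ∃ lam ∈ K, i ∈ J → 0 < lam (D.h i) := by
    intro i
    by_cases hi : i ∈ J
    · obtain ⟨lam, hl, hp⟩ := h i hi
      exact ⟨lam, hl, fun _ => hp⟩
    · exact ⟨0, K.zero_mem, fun h => absurd h hi⟩
  choose f hf hp using h'
  refine ⟨∑ i, f i, K.sum_mem fun i _ => hf i, fun i hi => ?_⟩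
  rw [sum_apply]
  exact Finset.sum_pos' (fun j _ => hK (hf j) i) ⟨i, Finset.mem_univ i, hp i hi⟩

theorem exists_mem_openChamber [Finite ι] : ∃ lam, lam ∈ openChamber D.h := by
  obtain ⟨lam, -, h⟩ := D.exists_pos_on (le_refl D.chamber) (J := Set.univ) fun i _ => by
    by_contra! hcon
    have hle : Submodule.span ℝ (closedChamber D.h : Set (StrongDual ℝ V)) ≤
        LinearMap.ker (ContinuousLinearMap.apply ℝ ℝ (D.h i) :
          StrongDual ℝ V →L[ℝ] ℝ).toLinearMap := by
      rw [Submodule.span_le]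
      intro lam hl
      exact le_antisymm (hcon lam hl) (hl i)
    rw [D.span_chamber] at hle
    have : D.α i (D.h i) = 0 := hle (Submodule.mem_top (x := D.α i))
    rw [D.pairing] at this
    norm_num at this
  exact ⟨lam, fun i => h i trivial⟩

/-- Evaluation at `h i` as a linear form on the dual space. -/
noncomputable def coroot (i : ι) : StrongDual ℝ V →ₗ[ℝ] ℝ :=
  (ContinuousLinearMap.apply ℝ ℝ (D.h i) : StrongDual ℝ V →L[ℝ] ℝ).toLinearMap

theorem coroot_apply (i : ι) (lam : StrongDual ℝ V) : D.coroot i lam = lam (D.h i) := rfl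

theorem coroot_ne_zero (i : ι) : D.coroot i ≠ 0 := by
  intro h
  have h1 : D.coroot i (D.α i) = 2 := D.pairing i
  rw [h] at h1
  norm_num at h1

/-- A wall has codimension one, so any hyperplane containing it is its span. -/
theorem span_chamberWall [FiniteDimensional ℝ V] {i j : ι}
    (h : ∀ lam ∈ chamberWall D.h i, lam (D.h j) = 0) :
    Submodule.span ℝ (chamberWall D.h i : Set (StrongDual ℝ V)) = LinearMap.ker (D.coroot j) := by
  have h1 := ((D.facets (chamberWall D.h i)).2 ⟨i, rfl⟩).2
  have h2 := Module.Dual.finrank_ker_add_one_of_ne_zero (D.coroot_ne_zero j)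
  refine Submodule.eq_of_le_of_finrank_eq (Submodule.span_le.2 h) ?_
  omega

/-- If h_j vanished on the wall i, both coroots would have the span of this wall as kernel, and the
walls i and j would coincide. So each h_j with j ≠ i is positive somewhere on the wall, and a sum of
such points works. -/
theorem exists_mem_wall [FiniteDimensional ℝ V] [Finite ι] (i : ι) :
    ∃ p : StrongDual ℝ V, p (D.h i) = 0 ∧ ∀ j, j ≠ i → 0 < p (D.h j) := by
  have hle : chamberWall D.h i ≤ D.chamber := fun lam hl => hl.1
  obtain ⟨p, hp, hpos⟩ := D.exists_pos_on hle (J := {j | j ≠ i}) fun j hj => by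
    by_contra! hcon
    refine hj (D.wall_injective ?_)
    have h1 := D.span_chamberWall (i := i) (j := j) fun lam hl =>
      le_antisymm (hcon lam hl) (hl.1 j)
    have h2 := D.span_chamberWall (i := i) (j := i) fun lam hl => hl.2
    have h3 : ∀ lam : StrongDual ℝ V, lam (D.h j) = 0 ↔ lam (D.h i) = 0 := by
      intro lam
      rw [← coroot_apply, ← coroot_apply, ← LinearMap.mem_ker, ← LinearMap.mem_ker, ← h1, ← h2]
    ext lam
    exact and_congr_right fun _ => h3 lam
  exact ⟨p, hp.2, hpos⟩

theorem eventually_pos {a b : ℝ} (h : 0 < a ∨ (0 ≤ a ∧ 0 < b)) :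
    ∀ᶠ ε in 𝓝[>] (0 : ℝ), 0 < a + ε * b := by
  rcases h with h | ⟨h, hb⟩
  · have : Tendsto (fun ε : ℝ => a + ε * b) (𝓝[>] 0) (𝓝 (a + 0 * b)) :=
      ((by fun_prop : Continuous fun ε : ℝ => a + ε * b).tendsto 0).mono_left nhdsWithin_le_nhds
    refine this.eventually (lt_mem_nhds (by simpa using h))
  · filter_upwards [self_mem_nhdsWithin] with ε (hε : 0 < ε)
    positivity

theorem eventually_nonneg {a b : ℝ} (h : 0 < a ∨ (0 ≤ a ∧ 0 ≤ b)) :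
    ∀ᶠ ε in 𝓝[>] (0 : ℝ), 0 ≤ a + ε * b := by
  rcases h with h | ⟨h, hb⟩
  · exact (eventually_pos (Or.inl h)).mono fun ε hε => hε.le
  · filter_upwards [self_mem_nhdsWithin] with ε (hε : 0 < ε)
    positivity

theorem eventually_mem_openChamber [Finite ι] {p v : StrongDual ℝ V}
    (h : ∀ i, 0 < p (D.h i) ∨ (0 ≤ p (D.h i) ∧ 0 < v (D.h i))) :
    ∀ᶠ ε in 𝓝[>] (0 : ℝ), p + ε • v ∈ openChamber D.h :=
  (eventually_all.2 fun i => eventually_pos (h i)).mono fun _ hε i => hε i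

theorem eventually_mem_chamber [Finite ι] {p v : StrongDual ℝ V}
    (h : ∀ i, 0 < p (D.h i) ∨ (0 ≤ p (D.h i) ∧ 0 ≤ v (D.h i))) :
    ∀ᶠ ε in 𝓝[>] (0 : ℝ), p + ε • v ∈ D.chamber :=
  (eventually_all.2 fun i => eventually_nonneg (h i)).mono fun _ hε i => hε i

/-- A chamber point becomes an open chamber point after adding a small multiple of one, so a
negative value would persist nearby. -/
theorem nonneg_of_openChamber [Finite ι] {f : StrongDual ℝ V →ₗ[ℝ] ℝ}
    (hf : ∀ lam ∈ openChamber D.h, 0 < f lam) {p : StrongDual ℝ V} (hp : p ∈ D.chamber) :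
    0 ≤ f p := by
  obtain ⟨c, hc⟩ := D.exists_mem_openChamber
  by_contra! hneg
  have h1 := D.eventually_mem_openChamber (p := p) (v := c) fun i => Or.inr ⟨hp i, hc i⟩
  have h2 := eventually_pos (a := - f p) (b := - f c) (Or.inl (by linarith))
  obtain ⟨ε, h1, h2⟩ := (h1.and h2).exists
  have := hf _ h1
  rw [map_add, map_smul, smul_eq_mul] at this
  linarith

theorem simple_injective [FiniteDimensional ℝ V] [Finite ι] : Function.Injective D.simple := by
  intro i j hij
  by_contra hne
  obtain ⟨p, hp, hpos⟩ := D.exists_mem_wall j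
  have h1 := D.simple_apply_eq_self hp
  rw [← hij, simple_apply_eq_self_iff] at h1
  exact (hpos i hne).ne' h1

/-! ### Sides of walls -/

/-- `σ C` lies on the negative side of the wall `i` of `C`. -/
def IsDescent (σ : D.W) (i : ι) : Prop := ∀ lam ∈ openChamber D.h, σ.1 lam (D.h i) < 0

/-- Otherwise the conjugate σ⁻¹σ_iσ would fix a point of the open chamber, hence be trivial. -/
theorem apply_h_ne_zero (σ : D.W) (i : ι) {lam : StrongDual ℝ V} (hl : lam ∈ openChamber D.h) :
    σ.1 lam (D.h i) ≠ 0 := by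
  intro h0
  have h1 : (σ⁻¹ * D.simple i * σ).1 lam = lam := by
    rw [mul_apply, mul_apply, D.simple_apply_eq_self h0, inv_apply_self]
  have h2 := D.eq_one_of_mem_openChamber hl (h1.symm ▸ hl)
  refine D.simple_ne_one i ?_
  calc D.simple i = σ * (σ⁻¹ * D.simple i * σ) * σ⁻¹ := by group
    _ = 1 := by rw [h2]; group

theorem pos_of_not_isDescent {σ : D.W} {i : ι} (h : ¬ D.IsDescent σ i) {lam : StrongDual ℝ V}
    (hl : lam ∈ openChamber D.h) : 0 < σ.1 lam (D.h i) := by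
  rw [IsDescent] at h
  push Not at h
  obtain ⟨μ, hμ, hpos⟩ := h
  have hpos := lt_of_le_of_ne hpos (D.apply_h_ne_zero σ i hμ).symm
  by_contra! hneg
  have hneg := lt_of_le_of_ne hneg (D.apply_h_ne_zero σ i hl)
  -- Values of both signs on the convex open chamber would give a positive combination with value
  -- zero.
  refine D.apply_h_ne_zero σ i
    (lam := (-(σ.1 lam (D.h i))) • μ + (σ.1 μ (D.h i)) • lam) (fun j => ?_) ?_
  · have := hl j
    have := hμ j
    simp only [add_apply, smul_apply, smul_eq_mul]
    have : 0 < -(σ.1 lam (D.h i)) := by linarith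
    positivity
  · simp only [map_add, map_smul, add_apply, smul_apply, smul_eq_mul]
    ring

theorem not_isDescent_iff [Finite ι] {σ : D.W} {i : ι} :
    ¬ D.IsDescent σ i ↔ ∀ lam ∈ openChamber D.h, 0 < σ.1 lam (D.h i) := by
  refine ⟨fun h lam hl => D.pos_of_not_isDescent h hl, fun h h' => ?_⟩
  obtain ⟨c, hc⟩ := D.exists_mem_openChamber
  exact lt_asymm (h c hc) (h' c hc)

theorem isDescent_simple_mul [Finite ι] (σ : D.W) (i : ι) :
    D.IsDescent (D.simple i * σ) i ↔ ¬ D.IsDescent σ i := by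
  rw [not_isDescent_iff]
  refine forall₂_congr fun lam _ => ?_
  rw [mul_apply, simple_apply_h, neg_lt_zero]

theorem nonneg_of_not_isDescent [Finite ι] {σ : D.W} {i : ι} (h : ¬ D.IsDescent σ i)
    {lam : StrongDual ℝ V} (hl : lam ∈ D.chamber) : 0 ≤ σ.1 lam (D.h i) :=
  D.nonneg_of_openChamber (f := D.coroot i ∘ₗ σ.1.toLinearMap)
    (fun _ hμ => D.pos_of_not_isDescent h hμ) hl

theorem nonpos_of_isDescent [Finite ι] {σ : D.W} {i : ι} (h : D.IsDescent σ i)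
    {lam : StrongDual ℝ V} (hl : lam ∈ D.chamber) : σ.1 lam (D.h i) ≤ 0 := by
  have := D.nonneg_of_openChamber (f := - (D.coroot i ∘ₗ σ.1.toLinearMap))
    (fun μ hμ => neg_pos.2 (h μ hμ)) hl
  exact neg_nonneg.1 this

/-- The form f = h_i ∘ σ is positive on C and both nonnegative and nonpositive on the wall j, so it
is a positive multiple of h_j. The reflection r = σ⁻¹σ_iσ then acts like σ_j near an inner point of
that wall, and simple transitivity on chambers forces r = σ_j. -/
theorem simple_mul_eq_mul_simple [FiniteDimensional ℝ V] [Finite ι] {σ : D.W} {i j : ι}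
    (h : ¬ D.IsDescent σ i) (h' : D.IsDescent (σ * D.simple j) i) :
    D.simple i * σ = σ * D.simple j := by
  set f : StrongDual ℝ V →ₗ[ℝ] ℝ := D.coroot i ∘ₗ σ.1.toLinearMap with hf
  have hfa : ∀ lam, f lam = σ.1 lam (D.h i) := fun _ => rfl
  have hpos : ∀ lam ∈ openChamber D.h, 0 < f lam := fun lam hl => D.pos_of_not_isDescent h hl
  have hker : LinearMap.ker (D.coroot j) ≤ LinearMap.ker f := by
    rw [← D.span_chamberWall (i := j) (j := j) fun lam hl => hl.2, Submodule.span_le]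
    intro p hp
    refine le_antisymm ?_ (D.nonneg_of_openChamber hpos hp.1)
    have := D.nonpos_of_isDescent h' hp.1
    rwa [mul_apply, D.simple_apply_eq_self hp.2] at this
  have hprop : ∀ lam, f lam = lam (D.h j) * (f (D.α j) / 2) := by
    intro lam
    have : lam - (lam (D.h j) / 2) • D.α j ∈ LinearMap.ker f := hker (by
      rw [LinearMap.mem_ker, coroot_apply]
      simp [D.pairing])
    rw [LinearMap.mem_ker, map_sub, map_smul, smul_eq_mul] at this
    linarith
  obtain ⟨c, hc⟩ := D.exists_mem_openChamber
  have hfα : 0 < f (D.α j) / 2 := by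
    have h1 := hpos c hc
    rw [hprop] at h1
    exact pos_of_mul_pos_right h1 (hc j).le
  obtain ⟨p, hp0, hp⟩ := D.exists_mem_wall j
  set r : D.W := σ⁻¹ * D.simple i * σ with hr
  have hfr : ∀ lam, f (r.1 lam) = - f lam := by
    intro lam
    rw [hr, mul_apply, mul_apply, hfa, apply_inv_self, simple_apply_h, hfa]
  have hrp : r.1 p = p := by
    have : σ.1 p (D.h i) = 0 := by rw [← hfa, hprop, hp0, zero_mul]
    rw [hr, mul_apply, mul_apply, D.simple_apply_eq_self this, inv_apply_self]
  -- Both σ_j c and r c are negative on h_j. Their negatives therefore point from p into C, and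
  -- rσ_j⁻¹ carries one of the resulting open chamber points to the other.
  have hgen : ∀ τ : D.W, 0 < - τ.1 c (D.h j) →
      ∀ᶠ ε in 𝓝[>] (0 : ℝ), p + ε • (- τ.1 c) ∈ openChamber D.h := by
    intro τ hτ
    refine D.eventually_mem_openChamber fun k => ?_
    by_cases hk : k = j
    · subst hk
      exact Or.inr ⟨hp0.ge, hτ⟩
    · exact Or.inl (hp k hk)
  have h1 := hgen (D.simple j) (by rw [simple_apply_h, neg_neg]; exact hc j)
  have h2 := hgen r (by
    have h3 := hfr c
    rw [hprop, hprop c, ← neg_mul] at h3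
    rw [mul_right_cancel₀ hfα.ne' h3, neg_neg]
    exact hc j)
  obtain ⟨ε, h1, h2⟩ := (h1.and h2).exists
  have h3 : (r * (D.simple j)⁻¹).1 (p + ε • (- (D.simple j).1 c)) = p + ε • (- r.1 c) := by
    rw [mul_apply, simple_inv, map_add, map_smul, map_neg, simple_simple_apply,
      D.simple_apply_eq_self hp0, map_add, map_smul, map_neg, hrp]
  have h4 := D.eq_one_of_mem_openChamber h1 (h3.symm ▸ h2)
  rw [mul_inv_eq_one] at h4
  rw [← h4, hr]
  group

theorem descentRelation [FiniteDimensional ℝ V] [Finite ι] :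
    DescentRelation D.simple D.IsDescent where
  sq := D.simple_mul_self
  closure_eq_top := D.closure_range_simple
  not_one i := D.not_isDescent_iff.2 fun _ hl => hl i
  simple_mul := D.isDescent_simple_mul
  fold _ _ _ := D.simple_mul_eq_mul_simple

theorem eq_one_of_forall_not_isDescent [Finite ι] {σ : D.W} (h : ∀ i, ¬ D.IsDescent σ i) :
    σ = 1 := by
  obtain ⟨c, hc⟩ := D.exists_mem_openChamber
  exact D.eq_one_of_mem_openChamber hc fun i => D.pos_of_not_isDescent (h i) hc

/-! ### Point stabilizers and the local structure of the Tits cone -/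

/-- The indices of the simple reflections which fix `lam`. -/
def zeroSet (lam : StrongDual ℝ V) : Set ι := {i | lam (D.h i) = 0}

theorem apply_eq_self_of_mem_standardParabolic {J : Set ι} {lam : StrongDual ℝ V}
    (hJ : ∀ i ∈ J, lam (D.h i) = 0) {σ : D.W} (hσ : σ ∈ standardParabolic D.simple J) :
    σ.1 lam = lam := by
  induction hσ using Subgroup.closure_induction with
  | mem x hx =>
    obtain ⟨i, hi, rfl⟩ := hx
    exact D.simple_apply_eq_self (hJ i hi)
  | one => rfl
  | mul x y _ _ hx hy => rw [mul_apply, hy, hx]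
  | inv x _ hx => conv_lhs => rw [← hx, inv_apply_self]

theorem simple_mem_standardParabolic {J : Set ι} {i : ι} (hi : i ∈ J) :
    D.simple i ∈ standardParabolic D.simple J := Subgroup.subset_closure ⟨i, hi, rfl⟩

variable [FiniteDimensional ℝ V] [Finite ι]

/-- The closed chamber is a fundamental domain with parabolic stabilizers. -/
theorem eq_and_mem_standardParabolic (σ : D.W) {lam μ : StrongDual ℝ V} (hl : lam ∈ D.chamber)
    (hμ : μ ∈ D.chamber) (h : σ.1 lam = μ) :
    lam = μ ∧ σ ∈ standardParabolic D.simple (D.zeroSet μ) := by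
  induction σ using D.descentRelation.induction with
  | hP σ ih =>
    by_cases hd : ∃ i, D.IsDescent σ i
    · obtain ⟨i, hi⟩ := hd
      -- The descent makes this value nonpositive and the chamber makes it nonnegative; hence σ_i
      -- fixes μ and can be split off σ.
      have h0 : μ (D.h i) = 0 :=
        le_antisymm (h ▸ D.nonpos_of_isDescent hi hl) (hμ i)
      obtain ⟨h1, h2⟩ := ih i hi (by rw [mul_apply, h, D.simple_apply_eq_self h0])
      refine ⟨h1, ?_⟩
      rw [← D.descentRelation.simple_mul_cancel i σ]
      exact mul_mem (D.simple_mem_standardParabolic h0) h2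
    · push Not at hd
      obtain rfl := D.eq_one_of_forall_not_isDescent hd
      exact ⟨h, one_mem _⟩

/-- Near a point `p` of the closed chamber, a segment from `p` into the Tits cone stays in one
closed chamber containing `p`. -/
theorem exists_add_smul_mem_chamber {p q : StrongDual ℝ V} (hp : p ∈ D.chamber)
    (hq : q ∈ D.titsCone) :
    ∃ σ ∈ standardParabolic D.simple (D.zeroSet p), ∃ ε : ℝ, 0 < ε ∧
      σ⁻¹.1 (p + ε • q) ∈ D.chamber := by
  obtain ⟨w, μ, hμ, hw⟩ := hq
  induction w using D.descentRelation.induction generalizing q with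
  | hP w ih =>
    by_cases hd : ∃ i, p (D.h i) = 0 ∧ q (D.h i) < 0
    · obtain ⟨i, h0, hlt⟩ := hd
      have hi : D.IsDescent w i := by
        by_contra hi
        have := D.nonneg_of_not_isDescent hi hμ
        rw [hw] at this
        linarith
      -- Reflecting in a wall through p leaves p in place, so the induction hypothesis applies to
      -- σ_i q.
      obtain ⟨σ, hσ, ε, hε, hmem⟩ := ih i hi (q := (D.simple i).1 q) (by rw [mul_apply, hw])
      refine ⟨D.simple i * σ, mul_mem (D.simple_mem_standardParabolic h0) hσ, ε, hε, ?_⟩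
      rw [mul_inv_rev, mul_apply, simple_inv, map_add, map_smul, D.simple_apply_eq_self h0]
      exact hmem
    -- Now q is nonnegative on every wall through p, so a short enough segment stays in the chamber.
    · push Not at hd
      have h1 := D.eventually_mem_chamber (p := p) (v := q) fun i => by
        rcases (hp i).lt_or_eq with h | h
        · exact Or.inl h
        · exact Or.inr ⟨hp i, hd i h.symm⟩
      obtain ⟨ε, h1, hε : 0 < ε⟩ := (h1.and self_mem_nhdsWithin).exists
      exact ⟨1, one_mem _, ε, hε, by simpa using h1⟩

end LinearCoxeterSystem

/-! ### Relative interiors of convex cones and of their faces -/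

section Relint

variable {E : Type*}

section Algebraic

variable [AddCommGroup E] [Module ℝ E]

/-- The algebraic relative interior of a convex cone. -/
def PointedCone.IsInternal (K : PointedCone ℝ E) (p : E) : Prop :=
  p ∈ K ∧ ∀ x ∈ K, ∃ ε : ℝ, 0 < ε ∧ p - ε • x ∈ K

namespace PointedCone.IsInternal

variable {K : PointedCone ℝ E} {p : E}

theorem add (hp : K.IsInternal p) {x : E} (hx : x ∈ K) : K.IsInternal (p + x) := by
  refine ⟨add_mem hp.1 hx, fun y hy => ?_⟩
  obtain ⟨ε, hε, hmem⟩ := hp.2 y hy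
  exact ⟨ε, hε, by rw [add_sub_right_comm]; exact add_mem hmem hx⟩

theorem smul (hp : K.IsInternal p) {c : ℝ} (hc : 0 < c) : K.IsInternal (c • p) := by
  refine ⟨K.smul_mem hc.le hp.1, fun y hy => ?_⟩
  obtain ⟨ε, hε, hmem⟩ := hp.2 y hy
  refine ⟨c * ε, mul_pos hc hε, ?_⟩
  rw [mul_smul, ← smul_sub]
  exact K.smul_mem hc.le hmem

/-- Write p = εx + (p - εx) with both summands in F; a face containing p contains x. -/
theorem le_of_mem {F F' : FaceLattice K} (hp : F.1.IsInternal p) (hp' : p ∈ F'.1) : F ≤ F' := by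
  intro x hx
  obtain ⟨ε, hε, hmem⟩ := hp.2 x hx
  exact F'.2.mem_of_smul_add_mem (F.2.le hx) (F.2.le hmem) hε (by
    rw [add_sub_cancel]
    exact hp')

theorem face_eq {F F' : FaceLattice K} (hp : F.1.IsInternal p) (hp' : F'.1.IsInternal p) :
    F = F' := le_antisymm (hp.le_of_mem hp'.1) (hp'.le_of_mem hp.1)

end PointedCone.IsInternal

theorem PointedCone.sub_smul_mem_of_le {K : PointedCone ℝ E} {p x : E} (hx : x ∈ K) {ε δ : ℝ}
    (hδ : δ ≤ ε) (h : p - ε • x ∈ K) : p - δ • x ∈ K := by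
  have : p - δ • x = (p - ε • x) + (ε - δ) • x := by module
  rw [this]
  exact add_mem h (K.smul_mem (sub_nonneg.2 hδ) hx)

/-- The smallest face of `K` which contains `p`. -/
def PointedCone.pointFace (K : PointedCone ℝ E) (p : E) (hp : p ∈ K) : PointedCone ℝ E where
  carrier := {x | x ∈ K ∧ ∃ ε : ℝ, 0 < ε ∧ p - ε • x ∈ K}
  add_mem' := by
    rintro x y ⟨hx, ε, hε, hex⟩ ⟨hy, δ, hδ, hey⟩
    refine ⟨add_mem hx hy, min ε δ / 2, by positivity, ?_⟩
    have hex' := K.sub_smul_mem_of_le hx (min_le_left ε δ) hex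
    have hey' := K.sub_smul_mem_of_le hy (min_le_right ε δ) hey
    have : p - (min ε δ / 2) • (x + y) =
        (1 / 2 : ℝ) • ((p - min ε δ • x) + (p - min ε δ • y)) := by module
    rw [this]
    exact K.smul_mem (by norm_num) (add_mem hex' hey')
  zero_mem' := ⟨K.zero_mem, 1, one_pos, by simpa using hp⟩
  smul_mem' := by
    rintro ⟨c, hc⟩ x ⟨hx, ε, hε, hex⟩
    refine ⟨K.smul_mem hc hx, ε / (c + 1), by positivity, ?_⟩
    have h1 : p - (ε / (c + 1)) • (c • x) = p - (ε / (c + 1) * c) • x := by rw [mul_smul]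
    change p - (ε / (c + 1)) • (c • x) ∈ K
    rw [h1]
    refine K.sub_smul_mem_of_le hx ?_ hex
    rw [div_mul_eq_mul_div, div_le_iff₀ (by positivity)]
    nlinarith

theorem PointedCone.exists_isInternal_face (K : PointedCone ℝ E) {p : E} (hp : p ∈ K) :
    ∃ F : FaceLattice K, F.1.IsInternal p := by
  refine ⟨⟨K.pointFace p hp, fun x hx => hx.1, ?_⟩, ⟨hp, 1, one_pos, by simp⟩, ?_⟩
  · rintro x y a hx hy ha ⟨-, ε, hε, hmem⟩
    refine ⟨hx, ε * a, mul_pos hε ha, ?_⟩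
    have : p - (ε * a) • x = (p - ε • (a • x + y)) + ε • y := by module
    rw [this]
    exact add_mem hmem (K.smul_mem hε.le hy)
  · rintro x ⟨hx, ε, hε, hmem⟩
    -- Halving ε leaves room: p - (ε/2)x is in K and is itself dominated by p, so it lies in the
    -- face.
    refine ⟨ε / 2, by positivity, K.sub_smul_mem_of_le hx (by linarith) hmem, 1, one_pos, ?_⟩
    have : p - (1 : ℝ) • (p - (ε / 2) • x) = (ε / 2) • x := by module
    rw [this]
    exact K.smul_mem (by positivity) hx

/-- The face in which p + p' is interior contains p and p', hence F and F'; conversely it is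
contained in every face containing both. -/
theorem PointedCone.IsInternal.sup {K : PointedCone ℝ E} {F F' : FaceLattice K} {p p' : E}
    (hp : F.1.IsInternal p) (hp' : F'.1.IsInternal p') : (F ⊔ F').1.IsInternal (p + p') := by
  have hK := F.2.le hp.1
  have hK' := F'.2.le hp'.1
  obtain ⟨G, hG⟩ := K.exists_isInternal_face (add_mem hK hK')
  have h1 : p ∈ G.1 ∧ p' ∈ G.1 := (G.2.add_mem_iff_mem hK hK').1 hG.1
  have h2 : F ⊔ F' = G := le_antisymm (sup_le (hp.le_of_mem h1.1) (hp'.le_of_mem h1.2))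
    (hG.le_of_mem (add_mem ((le_sup_left : F ≤ F ⊔ F') hp.1) ((le_sup_right : F' ≤ F ⊔ F') hp'.1)))
  rw [h2]
  exact hG

/-- If the spans agree, x in G is a difference a - b of elements of F; then x + b lies in F, and so
does x. In finite dimension this gives both chain conditions, even when there are infinitely many
faces. -/
theorem FaceLattice.span_strictMono (K : PointedCone ℝ E) :
    StrictMono fun F : FaceLattice K => Submodule.span ℝ (F.1 : Set E) := by
  intro F G hlt
  refine lt_of_le_of_ne (Submodule.span_mono hlt.le) fun heq => hlt.not_ge ?_
  have hsub : ∀ x ∈ Submodule.span ℝ (F.1 : Set E), ∃ a ∈ F.1, ∃ b ∈ F.1, x = a - b := by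
    intro x hx
    induction hx using Submodule.span_induction with
    | mem x hx => exact ⟨x, hx, 0, F.1.zero_mem, by simp⟩
    | zero => exact ⟨0, F.1.zero_mem, 0, F.1.zero_mem, by simp⟩
    | add x y _ _ hx hy =>
      obtain ⟨a, ha, b, hb, rfl⟩ := hx
      obtain ⟨c, hc, d, hd, rfl⟩ := hy
      exact ⟨a + c, add_mem ha hc, b + d, add_mem hb hd, by abel⟩
    | smul t x _ hx =>
      obtain ⟨a, ha, b, hb, rfl⟩ := hx
      rcases le_total 0 t with ht | ht
      · exact ⟨t • a, F.1.smul_mem ht ha, t • b, F.1.smul_mem ht hb, smul_sub _ _ _⟩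
      · exact ⟨(-t) • b, F.1.smul_mem (neg_nonneg.2 ht) hb, (-t) • a,
          F.1.smul_mem (neg_nonneg.2 ht) ha, by module⟩
  intro x hx
  obtain ⟨a, ha, b, hb, rfl⟩ := hsub x (by
    have h1 := Submodule.subset_span (R := ℝ) hx
    exact heq.ge h1)
  refine F.2.mem_of_add_mem_left (G.2.le hx) (F.2.le hb) ?_
  rwa [sub_add_cancel]

instance [FiniteDimensional ℝ E] (K : PointedCone ℝ E) : WellFoundedGT (FaceLattice K) :=
  (FaceLattice.span_strictMono K).wellFoundedGT

instance [FiniteDimensional ℝ E] (K : PointedCone ℝ E) : WellFoundedLT (FaceLattice K) :=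
  (FaceLattice.span_strictMono K).wellFoundedLT

end Algebraic

section Topological

variable [NormedAddCommGroup E] [NormedSpace ℝ E]

open Topology Filter

theorem PointedCone.sub_smul_mem_affineSpan {K : PointedCone ℝ E} {p x : E} (hp : p ∈ K)
    (hx : x ∈ K) (t : ℝ) : p - t • x ∈ affineSpan ℝ (K : Set E) := by
  have := AffineSubspace.smul_vsub_vadd_mem (affineSpan ℝ (K : Set E)) t
    (subset_affineSpan ℝ _ K.zero_mem) (subset_affineSpan ℝ _ hx) (subset_affineSpan ℝ _ hp)
  convert this using 1
  simp only [vsub_eq_sub, vadd_eq_add]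
  module

theorem PointedCone.isInternal_of_mem_intrinsicInterior {K : PointedCone ℝ E} {p : E}
    (hp : p ∈ intrinsicInterior ℝ (K : Set E)) : K.IsInternal p := by
  obtain ⟨y, hy, rfl⟩ := mem_intrinsicInterior.1 hp
  have hyK : y ∈ (Subtype.val ⁻¹' (K : Set E) : Set (affineSpan ℝ (K : Set E))) :=
    interior_subset hy
  refine ⟨hyK, fun x hx => ?_⟩
  let f : ℝ → affineSpan ℝ (K : Set E) :=
    fun t => ⟨(y : E) - t • x, K.sub_smul_mem_affineSpan hyK hx t⟩
  have hf : Continuous f := Continuous.subtype_mk (by fun_prop) _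
  have hf0 : f 0 = y := Subtype.ext (by simp [f])
  have h1 : ∀ᶠ t in 𝓝 (0 : ℝ), (f t : E) ∈ K :=
    hf.continuousAt.eventually (hf0.symm ▸ mem_interior_iff_mem_nhds.1 hy)
  obtain ⟨t, h1, ht : 0 < t⟩ :=
    ((h1.filter_mono nhdsWithin_le_nhds).and (self_mem_nhdsWithin (s := Set.Ioi 0))).exists
  exact ⟨t, ht, h1⟩

theorem PointedCone.mem_intrinsicInterior_iff [FiniteDimensional ℝ E] {K : PointedCone ℝ E}
    {p : E} : p ∈ intrinsicInterior ℝ (K : Set E) ↔ K.IsInternal p := by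
  refine ⟨K.isInternal_of_mem_intrinsicInterior, fun hp => ?_⟩
  obtain ⟨q, hq⟩ := Set.Nonempty.intrinsicInterior K.convex ⟨0, K.zero_mem⟩
  obtain ⟨y, hy, rfl⟩ := mem_intrinsicInterior.1 hq
  have hyK : y ∈ (Subtype.val ⁻¹' (K : Set E) : Set (affineSpan ℝ (K : Set E))) :=
    interior_subset hy
  obtain ⟨ε, hε, hmem⟩ := hp.2 y hyK
  let P : affineSpan ℝ (K : Set E) := ⟨p, subset_affineSpan ℝ _ hp.1⟩
  -- The homothety z ↦ y + ε⁻¹(z - p) carries p to the topologically interior point y; pulling back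
  -- a neighbourhood of y and adding p - εy gives one of p inside K.
  have hA : ∀ z : affineSpan ℝ (K : Set E), (y : E) + ε⁻¹ • (z - p) ∈ affineSpan ℝ (K : Set E) :=
    fun z => AffineSubspace.smul_vsub_vadd_mem _ ε⁻¹ z.2 P.2 y.2 |> fun h => by
      rwa [vsub_eq_sub, vadd_eq_add, add_comm] at h
  let f : affineSpan ℝ (K : Set E) → affineSpan ℝ (K : Set E) := fun z => ⟨_, hA z⟩
  have hf : Continuous f := Continuous.subtype_mk (by fun_prop) _
  have hfP : f P = y := Subtype.ext (by simp [f, P])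
  have h1 : ∀ᶠ z in 𝓝 P, (f z : E) ∈ K :=
    hf.continuousAt.eventually (hfP.symm ▸ mem_interior_iff_mem_nhds.1 hy)
  refine mem_intrinsicInterior.2 ⟨P, mem_interior_iff_mem_nhds.2 ?_, rfl⟩
  filter_upwards [h1] with z hz
  have : (z : E) = (p - ε • (y : E)) + ε • ((y : E) + ε⁻¹ • (z - p)) := by
    rw [smul_add, smul_inv_smul₀ hε.ne']
    abel
  change (z : E) ∈ K
  rw [this]
  exact add_mem hmem (K.smul_mem hε.le hz)

theorem PointedCone.exists_isInternal [FiniteDimensional ℝ E] (K : PointedCone ℝ E) :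
    ∃ p, K.IsInternal p := by
  obtain ⟨p, hp⟩ := Set.Nonempty.intrinsicInterior K.convex ⟨0, K.zero_mem⟩
  exact ⟨p, K.isInternal_of_mem_intrinsicInterior hp⟩

end Topological

end Relint

/-! ### The cross section of the face lattice -/

section CompleteLattice

variable {α : Type*} [CompleteLattice α] {U : Set α}

/-- A minimal element of U above the infimum must lie below every member of s, since meeting it with
one gives nothing smaller. -/
theorem sInf_mem_of_inf_mem [WellFoundedLT α] (htop : ⊤ ∈ U)
    (hinf : ∀ a ∈ U, ∀ b ∈ U, a ⊓ b ∈ U) {s : Set α} (hs : s ⊆ U) : sInf s ∈ U := by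
  obtain ⟨a, ⟨haU, ha⟩, hmin⟩ := wellFounded_lt.has_min {a | a ∈ U ∧ sInf s ≤ a} ⟨⊤, htop, le_top⟩
  have : sInf s = a := le_antisymm ha (le_sInf fun b hb => by
    by_contra hle
    exact hmin (a ⊓ b) ⟨hinf a haU b (hs hb), le_inf ha (sInf_le hb)⟩ (inf_lt_left.2 hle))
  rwa [this]

theorem sSup_mem_of_sup_mem [WellFoundedGT α] (hbot : ⊥ ∈ U)
    (hsup : ∀ a ∈ U, ∀ b ∈ U, a ⊔ b ∈ U) {s : Set α} (hs : s ⊆ U) : sSup s ∈ U := by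
  obtain ⟨a, ⟨haU, ha⟩, hmax⟩ := wellFounded_gt.has_min {a | a ∈ U ∧ a ≤ sSup s} ⟨⊥, hbot, bot_le⟩
  have : sSup s = a := le_antisymm (sSup_le fun b hb => by
    by_contra hle
    exact hmax (a ⊔ b) ⟨hsup a haU b (hs hb), sup_le ha (le_sSup hb)⟩ (left_lt_sup.2 hle)) ha
  rwa [this]

end CompleteLattice

/-- The smallest ratio x(h_i)/(-y(h_i)) over the walls with y(h_i) < 0 marks the first wall met. In
a cone the point x + cy replaces a point of the segment from x to y. -/
theorem LinearCoxeterSystem.exists_exit_point {ι V : Type*} [Finite ι] [NormedAddCommGroup V]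
    [NormedSpace ℝ V] (D : LinearCoxeterSystem ι V) {x y : StrongDual ℝ V} (hx : x ∈ D.chamber)
    (hy : y ∉ D.chamber) :
    ∃ i, ∃ c : ℝ, 0 ≤ c ∧ y (D.h i) < 0 ∧ x + c • y ∈ D.chamber ∧ (x + c • y) (D.h i) = 0 := by
  have hne : {i | y (D.h i) < 0}.Nonempty := by
    rw [D.mem_chamber] at hy
    push Not at hy
    exact hy
  obtain ⟨i, hi : y (D.h i) < 0, hmin⟩ := Set.exists_min_image {i | y (D.h i) < 0}
    (fun i => x (D.h i) / (- y (D.h i))) (Set.toFinite _) hne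
  have hc : 0 ≤ x (D.h i) / (- y (D.h i)) := div_nonneg (hx i) (by linarith)
  refine ⟨i, _, hc, hi, fun j => ?_, ?_⟩
  · rw [add_apply, smul_apply, smul_eq_mul]
    rcases lt_or_ge (y (D.h j)) 0 with hj | hj
    · have h1 := hmin j hj
      have h2 : 0 < - y (D.h j) := by linarith
      have h3 := (le_div_iff₀ h2).1 h1
      linarith
    · have := hx j
      positivity
  · rw [add_apply, smul_apply, smul_eq_mul]
    have : y (D.h i) ≠ 0 := hi.ne
    field_simp
    ring

theorem TypeMapPairs.exists_mk_eq {ι G U : Type*} [Group G] {s : ι → G} {lam : U → Set ι}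
    (x : TypeMapPairs s lam) : ∃ u σ, TypeMapPairs.mk s lam u σ = x := by
  obtain ⟨u, q⟩ := x
  obtain ⟨σ, rfl⟩ := QuotientGroup.mk_surjective q
  exact ⟨u, σ, rfl⟩

namespace InvariantSubcone

open LinearCoxeterSystem

variable {ι V : Type*} [NormedAddCommGroup V] [NormedSpace ℝ V]
  {D : LinearCoxeterSystem ι V} {Y : InvariantSubcone D}

theorem apply_mem_smul {σ : D.W} {F : Y.Face} {x : StrongDual ℝ V} (hx : x ∈ F.1) :
    σ.1 x ∈ (σ • F).1 := by
  rwa [mem_smul_iff, D.inv_apply_self]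

theorem isInternal_smul {F : Y.Face} {p : StrongDual ℝ V} (hp : F.1.IsInternal p) (σ : D.W) :
    (σ • F).1.IsInternal (σ.1 p) := by
  refine ⟨apply_mem_smul hp.1, fun x hx => ?_⟩
  obtain ⟨ε, hε, hmem⟩ := hp.2 _ ((mem_smul_iff σ F x).1 hx)
  refine ⟨ε, hε, ?_⟩
  rwa [mem_smul_iff, map_sub, map_smul, D.inv_apply_self]

theorem smul_mono (σ : D.W) {F G : Y.Face} (h : F ≤ G) : σ • F ≤ σ • G :=
  fun x hx => (mem_smul_iff σ G x).2 (h ((mem_smul_iff σ F x).1 hx))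

theorem smul_le_smul_iff (σ : D.W) {F G : Y.Face} : σ • F ≤ σ • G ↔ F ≤ G := by
  refine ⟨fun h => ?_, smul_mono σ⟩
  simpa using smul_mono σ⁻¹ h

theorem smul_eq_of_apply_eq {σ : D.W} {F : Y.Face} {p : StrongDual ℝ V} (hp : F.1.IsInternal p)
    (h : σ.1 p = p) : σ • F = F := by
  have := isInternal_smul hp σ
  rw [h] at this
  exact this.face_eq hp

theorem simple_smul_eq {i : ι} {F : Y.Face} {p : StrongDual ℝ V} (hp : F.1.IsInternal p)
    (h : p (D.h i) = 0) : D.simple i • F = F :=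
  smul_eq_of_apply_eq hp (D.simple_apply_eq_self h)

/-- The indices of the simple reflections which stabilize the face `F`. -/
def faceType (F : Y.Face) : Set ι := {i | D.simple i • F = F}

/-- The indices of the simple reflections which fix the face `F` pointwise. -/
def faceLowerType (F : Y.Face) : Set ι := {i | Y.Fixes (D.simple i) F}

theorem smul_eq_of_mem_standardParabolic {σ : D.W} {F : Y.Face}
    (h : σ ∈ standardParabolic D.simple (faceType F)) : σ • F = F := by
  have : standardParabolic D.simple (faceType F) ≤ MulAction.stabilizer D.W F := by
    rw [standardParabolic, Subgroup.closure_le]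
    rintro _ ⟨i, hi, rfl⟩
    exact hi
  exact this h

theorem mem_faceLowerType_iff {F : Y.Face} {i : ι} :
    i ∈ faceLowerType F ↔ ∀ x ∈ F.1, x (D.h i) = 0 :=
  forall₂_congr fun _ _ => D.simple_apply_eq_self_iff

/-- The map `(R, σ W_{υ(R)}) ↦ σ R`. -/
noncomputable def pairsToFace (x : TypeMapPairs D.simple Y.typeMap) : Y.Face :=
  Quotient.liftOn' x.2 (fun σ => σ • x.1.1) fun σ τ h => by
    rw [QuotientGroup.leftRel_apply] at h
    have := smul_eq_of_mem_standardParabolic (F := x.1.1) h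
    rw [mul_smul, inv_smul_eq_iff] at this
    exact this.symm

theorem pairsToFace_mk (R : Y.crossSection) (σ : D.W) :
    pairsToFace (TypeMapPairs.mk D.simple Y.typeMap R σ) = σ • R.1 := rfl

variable [FiniteDimensional ℝ V]

/-! ### Υ as a fundamental domain for the faces -/

theorem mem_crossSection {F : Y.Face} :
    F ∈ Y.crossSection ↔ ∃ p ∈ D.chamber, F.1.IsInternal p := by
  refine exists_congr fun p => ?_
  rw [Set.mem_inter_iff, PointedCone.mem_intrinsicInterior_iff, and_comm]
  rfl

theorem exists_smul_mem_crossSection (F : Y.Face) :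
    ∃ σ : D.W, ∃ S ∈ Y.crossSection, F = σ • S := by
  obtain ⟨p, hp⟩ := F.1.exists_isInternal
  obtain ⟨σ, μ, hμ, hσ⟩ := Y.subset_titsCone (F.2.le hp.1)
  refine ⟨σ, σ⁻¹ • F, mem_crossSection.2 ⟨μ, hμ, ?_⟩, by rw [smul_inv_smul]⟩
  have := isInternal_smul hp σ⁻¹
  rwa [← hσ, D.inv_apply_self] at this

theorem top_mem_crossSection : ⊤ ∈ Y.crossSection := by
  obtain ⟨σ, S, hS, h⟩ := exists_smul_mem_crossSection (⊤ : Y.Face)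
  rw [eq_comm, ← eq_inv_smul_iff, smul_top] at h
  exact h ▸ hS

theorem bot_mem_crossSection : ⊥ ∈ Y.crossSection := by
  obtain ⟨σ, S, hS, h⟩ := exists_smul_mem_crossSection (⊥ : Y.Face)
  have h1 : σ • S ≤ σ • (⊥ : Y.Face) := h ▸ bot_le
  rw [smul_le_smul_iff, le_bot_iff] at h1
  exact h1 ▸ hS

theorem sup_mem_crossSection {R T : Y.Face} (hR : R ∈ Y.crossSection) (hT : T ∈ Y.crossSection) :
    R ⊔ T ∈ Y.crossSection := by
  obtain ⟨p, hp, hpR⟩ := mem_crossSection.1 hR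
  obtain ⟨q, hq, hqT⟩ := mem_crossSection.1 hT
  exact mem_crossSection.2 ⟨p + q, add_mem hp hq, hpR.sup hqT⟩

variable [Finite ι]

/-- The segment from x to y exits through a wall i at an interior point of F, so σ_i stabilizes F.
Continue from the exit point towards σ_i y; since i is a descent of w, this terminates. -/
theorem exists_inv_apply_mem_chamber {F : Y.Face} {x y : StrongDual ℝ V} (hx : x ∈ D.chamber)
    (hxF : F.1.IsInternal x) (hyF : F.1.IsInternal y) :
    ∃ σ ∈ standardParabolic D.simple (faceType F), σ⁻¹.1 y ∈ D.chamber := by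
  obtain ⟨w, μ, hμ, hw⟩ := Y.subset_titsCone (F.2.le hyF.1)
  induction w using D.descentRelation.induction generalizing x y with
  | hP w ih =>
    by_cases hy : y ∈ D.chamber
    · exact ⟨1, one_mem _, by simpa using hy⟩
    · obtain ⟨i, c, hc, hlt, hmem, h0⟩ := D.exists_exit_point hx hy
      have hi : D.IsDescent w i := by
        by_contra hi
        have := D.nonneg_of_not_isDescent hi hμ
        rw [hw] at this
        linarith
      have hr : F.1.IsInternal (x + c • y) := hxF.add (F.1.smul_mem hc hyF.1)
      have hF := simple_smul_eq hr h0
      have hy' := isInternal_smul hyF (D.simple i)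
      rw [hF] at hy'
      obtain ⟨σ, hσ, hσy⟩ := ih i hi hmem hr hy' (by rw [mul_apply, hw])
      refine ⟨D.simple i * σ, mul_mem (D.simple_mem_standardParabolic hF) hσ, ?_⟩
      rwa [mul_inv_rev, mul_apply, simple_inv]

/-- An interior point p of S is carried into the interior of T and returned to the chamber by some τ
in the parabolic of T. It is then p again, so S = T; reflections fixing p stabilize T, so τ⁻¹σ also
lies in that parabolic. -/
theorem eq_and_mem_of_smul_eq {σ : D.W} {S T : Y.Face} (hS : S ∈ Y.crossSection)
    (hT : T ∈ Y.crossSection) (h : σ • S = T) :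
    S = T ∧ σ ∈ standardParabolic D.simple (faceType T) := by
  obtain ⟨p, hp, hpS⟩ := mem_crossSection.1 hS
  obtain ⟨q, hq, hqT⟩ := mem_crossSection.1 hT
  have hσp : T.1.IsInternal (σ.1 p) := h ▸ isInternal_smul hpS σ
  obtain ⟨τ, hτ, hmem⟩ := exists_inv_apply_mem_chamber hq hqT hσp
  obtain ⟨h1, h2⟩ := D.eq_and_mem_standardParabolic (τ⁻¹ * σ) hp hmem rfl
  have hpT : T.1.IsInternal p := by
    have := isInternal_smul hσp τ⁻¹
    rwa [← h1, smul_eq_of_mem_standardParabolic (inv_mem hτ)] at this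
  refine ⟨hpS.face_eq hpT, ?_⟩
  have h3 : τ⁻¹ * σ ∈ standardParabolic D.simple (faceType T) := by
    refine Subgroup.closure_mono (Set.image_mono fun i hi => ?_) h2
    rw [← h1] at hi
    exact simple_smul_eq hpT hi
  have := mul_mem hτ h3
  rwa [mul_inv_cancel_left] at this

theorem smul_eq_self_iff {σ : D.W} {S : Y.Face} (hS : S ∈ Y.crossSection) :
    σ • S = S ↔ σ ∈ standardParabolic D.simple (faceType S) :=
  ⟨fun h => (eq_and_mem_of_smul_eq hS hS h).2, smul_eq_of_mem_standardParabolic⟩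

/-! ### Generic points and the lower and upper types -/

theorem exists_generic_point {S : Y.Face} (hS : S ∈ Y.crossSection) :
    ∃ p ∈ D.chamber, S.1.IsInternal p ∧ D.zeroSet p = faceLowerType S := by
  obtain ⟨p₀, hp₀, hpS₀⟩ := mem_crossSection.1 hS
  -- Adding q makes every coroot positive that is positive anywhere on S ∩ C̄.
  obtain ⟨q, hq, hpos⟩ := D.exists_pos_on (K := S.1 ⊓ D.chamber) inf_le_right
    (J := {i | ∃ x ∈ S.1 ⊓ D.chamber, 0 < x (D.h i)}) fun _ h => h
  have hp : p₀ + q ∈ D.chamber := add_mem hp₀ hq.2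
  have hpS : S.1.IsInternal (p₀ + q) := hpS₀.add hq.1
  have hgen : ∀ k, (p₀ + q) (D.h k) = 0 → ∀ x ∈ S.1, x ∈ D.chamber → x (D.h k) = 0 := by
    intro k hk x hxS hx
    by_contra hne
    have h1 := hpos k ⟨x, ⟨hxS, hx⟩, lt_of_le_of_ne (hx k) (Ne.symm hne)⟩
    have h2 := hp₀ k
    rw [add_apply] at hk
    linarith
  refine ⟨p₀ + q, hp, hpS, Set.Subset.antisymm (fun i hi => ?_) fun i hi =>
    mem_faceLowerType_iff.1 hi _ hpS.1⟩
  refine mem_faceLowerType_iff.2 fun y hy => ?_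
  -- To pass from S ∩ C̄ to all of S, move p + εy into the chamber by an element fixing p. The image
  -- lies in S ∩ C̄, is killed by all coroots vanishing at p, and so is fixed by σ: nothing was
  -- moved.
  obtain ⟨σ, hσ, ε, hε, hmem⟩ := D.exists_add_smul_mem_chamber hp (Y.subset_titsCone (S.2.le hy))
  have hσp := D.apply_eq_self_of_mem_standardParabolic (fun i hi => hi) hσ
  have hzS : σ⁻¹.1 (p₀ + q + ε • y) ∈ S.1 := by
    rw [← mem_smul_iff, smul_eq_of_apply_eq hpS hσp]
    exact add_mem hpS.1 (S.1.smul_mem hε.le hy)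
  have hz := D.apply_eq_self_of_mem_standardParabolic
    (lam := σ⁻¹.1 (p₀ + q + ε • y)) (fun k hk => hgen k hk _ hzS hmem) hσ
  rw [apply_inv_self] at hz
  have h1 := hgen i hi _ hzS hmem
  have h2 : (p₀ + q) (D.h i) = 0 := hi
  rw [← hz, add_apply, h2, smul_apply, smul_eq_mul, zero_add] at h1
  exact (mul_eq_zero.1 h1).resolve_left hε.ne'

theorem fixes_iff {σ : D.W} {S : Y.Face} (hS : S ∈ Y.crossSection) :
    Y.Fixes σ S ↔ σ ∈ standardParabolic D.simple (faceLowerType S) := by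
  refine ⟨fun h => ?_, fun h x hx => ?_⟩
  · obtain ⟨p, hp, hpS, hZ⟩ := exists_generic_point hS
    rw [← hZ]
    exact (D.eq_and_mem_standardParabolic σ hp hp (h p hpS.1)).2
  · exact D.apply_eq_self_of_mem_standardParabolic
      (fun i hi => mem_faceLowerType_iff.1 hi x hx) h

/-- A generic p in S has p(h_i) > 0, while σ_i p lies in S ⊆ T on the negative side. Adding a
suitable multiple of σ_i p to an interior chamber point of T reaches the wall i inside the relative
interior of T. -/
theorem upper_type_mono {S T : Y.Face} (hS : S ∈ Y.crossSection) (hT : T ∈ Y.crossSection)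
    (hST : S ≤ T) {i : ι} (hi : i ∈ faceType S) (hi' : i ∉ faceLowerType S) :
    i ∈ faceType T ∧ i ∉ faceLowerType T := by
  refine ⟨?_, fun h => hi' fun x hx => h x (hST hx)⟩
  obtain ⟨p, hp, hpS, hZ⟩ := exists_generic_point hS
  obtain ⟨q, hq, hqT⟩ := mem_crossSection.1 hT
  have hpi : 0 < p (D.h i) := by
    refine lt_of_le_of_ne (hp i) fun h0 => hi' ?_
    rw [← hZ]
    exact h0.symm
  have hmem : (D.simple i).1 p ∈ T.1 := by
    have := apply_mem_smul (σ := D.simple i) hpS.1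
    rw [show D.simple i • S = S from hi] at this
    exact hST this
  refine simple_smul_eq (hqT.add (T.1.smul_mem (div_nonneg (hq i) hpi.le) hmem)) ?_
  rw [add_apply, smul_apply, simple_apply_h, smul_eq_mul]
  field_simp
  ring

/-! ### Chains of faces and meets -/

theorem exists_smul_chain {m : ℕ} (R : Fin m → Y.Face) (hR : Monotone R) :
    ∃ σ : D.W, ∀ k, σ⁻¹ • R k ∈ Y.crossSection := by
  suffices h : ∀ n ≤ m, ∃ σ : D.W, ∀ k : Fin m, k.1 < n → σ⁻¹ • R k ∈ Y.crossSection by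
    obtain ⟨σ, hσ⟩ := h m le_rfl
    exact ⟨σ, fun k => hσ k k.2⟩
  intro n
  induction n with
  | zero => exact fun _ => ⟨1, fun k hk => absurd hk (Nat.not_lt_zero _)⟩
  | succ n ih =>
    intro hn
    obtain ⟨σ, hσ⟩ := ih (by omega)
    have hσ' : ∀ k : Fin m, ∃ p ∈ D.chamber, k.1 < n → (σ⁻¹ • R k).1.IsInternal p := by
      intro k
      by_cases hk : k.1 < n
      · obtain ⟨p, hp, hpR⟩ := mem_crossSection.1 (hσ k hk)
        exact ⟨p, hp, fun _ => hpR⟩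
      · exact ⟨0, D.chamber.zero_mem, fun h => absurd h hk⟩
    choose p hp hpR using hσ'
    set s : Finset (Fin m) := Finset.univ.filter fun k => k.1 < n with hs
    -- The coroots are nonnegative on the p_k, so one vanishing at P vanishes at each summand: the
    -- parabolic fixing P fixes every p_k and keeps the faces already treated in Υ. Since P lies in
    -- the next face, P + εq is interior to it.
    set P := ∑ k ∈ s, p k with hP
    let a : Fin m := ⟨n, hn⟩
    have hPC : P ∈ D.chamber := sum_mem fun k _ => hp k
    have hPR : P ∈ (σ⁻¹ • R a).1 := sum_mem fun k hk => by
      have hk : k.1 < n := (Finset.mem_filter.1 hk).2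
      exact smul_mono σ⁻¹ (hR (show k ≤ a from hk.le)) (hpR k hk).1
    obtain ⟨q, hq⟩ := (σ⁻¹ • R a).1.exists_isInternal
    obtain ⟨τ, hτ, ε, hε, hmem⟩ :=
      D.exists_add_smul_mem_chamber hPC (Y.subset_titsCone ((σ⁻¹ • R a).2.le hq.1))
    refine ⟨σ * τ, fun k hk => ?_⟩
    rw [mul_inv_rev, mul_smul]
    rcases Nat.lt_succ_iff_lt_or_eq.1 hk with hk | hk
    · refine mem_crossSection.2 ⟨p k, hp k, ?_⟩
      have h1 : τ⁻¹.1 (p k) = p k := by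
        refine D.apply_eq_self_of_mem_standardParabolic (fun i hi => ?_) (inv_mem hτ)
        have hi : P (D.h i) = 0 := hi
        rw [hP, sum_apply] at hi
        exact (Finset.sum_eq_zero_iff_of_nonneg fun j _ => hp j i).1 hi k
          (Finset.mem_filter.2 ⟨Finset.mem_univ _, hk⟩)
      have := isInternal_smul (hpR k hk) τ⁻¹
      rwa [h1] at this
    · obtain rfl : k = a := Fin.ext hk
      refine mem_crossSection.2 ⟨_, hmem, isInternal_smul ?_ τ⁻¹⟩
      rw [add_comm]
      exact (hq.smul hε).add hPR

theorem existsUnique_chain {m : ℕ} (R : Fin m → Y.Face) (hR : Monotone R) :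
    ∃! S : Fin m → Y.Face, Monotone S ∧ (∀ i, S i ∈ Y.crossSection) ∧
      ∃ σ : D.W, ∀ i, R i = σ • S i := by
  obtain ⟨σ, hσ⟩ := exists_smul_chain R hR
  refine ⟨fun k => σ⁻¹ • R k, ⟨fun k l hkl => smul_mono _ (hR hkl), hσ, σ,
    fun k => by rw [smul_inv_smul]⟩, ?_⟩
  rintro T ⟨-, hT, τ, hτ⟩
  funext k
  refine (eq_and_mem_of_smul_eq (σ := σ⁻¹ * τ) (hT k) (hσ k) ?_).1
  rw [mul_smul, ← hτ k]

theorem exists_smul_pair {R T : Y.Face} (h : R ≤ T) :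
    ∃ σ : D.W, ∃ S ∈ Y.crossSection, ∃ S' ∈ Y.crossSection, S ≤ S' ∧ R = σ • S ∧ T = σ • S' := by
  obtain ⟨σ, hσ⟩ := exists_smul_chain (m := 2) ![R, T] (by
    rw [Fin.monotone_iff_le_succ]
    intro i
    fin_cases i
    exact h)
  exact ⟨σ, σ⁻¹ • R, hσ 0, σ⁻¹ • T, hσ 1, smul_mono _ h, by rw [smul_inv_smul],
    by rw [smul_inv_smul]⟩

theorem exists_common_smul {R T : Y.Face} (hR : R ∈ Y.crossSection) (hT : T ∈ Y.crossSection)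
    {σ τ : D.W} (h : σ • R ≤ τ • T) : R ≤ T ∧ ∃ g : D.W, g • R = σ • R ∧ g • T = τ • T := by
  obtain ⟨g, S, hS, S', hS', hle, h1, h2⟩ := exists_smul_pair h
  obtain rfl := (eq_and_mem_of_smul_eq (σ := g⁻¹ * σ) hR hS
    (by rw [mul_smul, h1, inv_smul_smul])).1
  obtain rfl := (eq_and_mem_of_smul_eq (σ := g⁻¹ * τ) hT hS'
    (by rw [mul_smul, h2, inv_smul_smul])).1
  exact ⟨hle, g, h1.symm, h2.symm⟩

/-- Write R ∩ T = σS with S in Υ. Then S ⊆ R and S ⊆ T, so S ⊆ σS, and a common representative of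
this pair shows S = σS. -/
theorem inf_mem_crossSection {R T : Y.Face} (hR : R ∈ Y.crossSection) (hT : T ∈ Y.crossSection) :
    R ⊓ T ∈ Y.crossSection := by
  obtain ⟨σ, S, hS, h⟩ := exists_smul_mem_crossSection (R ⊓ T)
  have hle : ∀ G ∈ Y.crossSection, R ⊓ T ≤ G → S ≤ G := fun G hG hle =>
    (exists_common_smul (σ := σ) (τ := 1) hS hG (by rwa [← h, one_smul])).1
  have h1 : (1 : D.W) • S ≤ σ • S := by
    rw [one_smul, ← h]
    exact le_inf (hle R hR inf_le_left) (hle T hT inf_le_right)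
  obtain ⟨-, g, h2, h3⟩ := exists_common_smul hS hS h1
  rw [h, ← h3, h2, one_smul]
  exact hS

theorem exists_completeSublattice :
    ∃ L : CompleteSublattice Y.Face, (L : Set Y.Face) = Y.crossSection :=
  ⟨CompleteSublattice.mk' Y.crossSection
    (fun _ => sSup_mem_of_sup_mem bot_mem_crossSection
      fun _ ha _ hb => sup_mem_crossSection ha hb)
    (fun _ => sInf_mem_of_inf_mem top_mem_crossSection
      fun _ ha _ hb => inf_mem_crossSection ha hb), rfl⟩

/-! ### Faces as pairs of a type and a coset -/

theorem pairsToFace_le_iff (x y : TypeMapPairs D.simple Y.typeMap) :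
    pairsToFace x ≤ pairsToFace y ↔ x ≤ y := by
  obtain ⟨R, σ, rfl⟩ := TypeMapPairs.exists_mk_eq x
  obtain ⟨T, τ, rfl⟩ := TypeMapPairs.exists_mk_eq y
  rw [pairsToFace_mk, pairsToFace_mk]
  have hcoset : ∀ (S : Y.crossSection) (g ρ : D.W), g • S.1 = ρ • S.1 →
      (g : D.W ⧸ standardParabolic D.simple (Y.typeMap S)) = ρ := by
    intro S g ρ h
    refine QuotientGroup.eq.2 ((smul_eq_self_iff S.2).1 ?_)
    rw [mul_smul, ← h, inv_smul_smul]
  constructor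
  · intro h
    obtain ⟨hle, g, h1, h2⟩ := exists_common_smul R.2 T.2 h
    exact ⟨hle, g, hcoset R g σ h1, hcoset T g τ h2⟩
  · rintro ⟨hle, g, h1, h2⟩
    have hs : ∀ (S : Y.crossSection) (ρ : D.W),
        (g : D.W ⧸ standardParabolic D.simple (Y.typeMap S)) = ρ → g • S.1 = ρ • S.1 :=
      fun S ρ h => by rw [← pairsToFace_mk, ← pairsToFace_mk, TypeMapPairs.mk, h]; rfl
    rw [← hs R σ h1, ← hs T τ h2]
    exact smul_mono g hle

theorem pairsToFace_bijective : Function.Bijective (pairsToFace (Y := Y)) := by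
  constructor
  · intro x y h
    obtain ⟨R, σ, rfl⟩ := TypeMapPairs.exists_mk_eq x
    obtain ⟨T, τ, rfl⟩ := TypeMapPairs.exists_mk_eq y
    rw [pairsToFace_mk, pairsToFace_mk] at h
    obtain ⟨h1, h2⟩ := eq_and_mem_of_smul_eq (σ := τ⁻¹ * σ) R.2 T.2
      (by rw [mul_smul, h, inv_smul_smul])
    obtain rfl : R = T := Subtype.ext h1
    refine congrArg (Sigma.mk R) (QuotientGroup.eq.2 ?_)
    have := inv_mem h2
    rwa [mul_inv_rev, inv_inv] at this
  · intro F
    obtain ⟨σ, S, hS, rfl⟩ := exists_smul_mem_crossSection F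
    exact ⟨TypeMapPairs.mk _ _ ⟨S, hS⟩ σ, rfl⟩

/-- The order isomorphism `(R, σ W_{υ(R)}) ↦ σ R`. -/
noncomputable def pairsOrderIso : TypeMapPairs D.simple Y.typeMap ≃o Y.Face where
  toEquiv := Equiv.ofBijective pairsToFace pairsToFace_bijective
  map_rel_iff' := pairsToFace_le_iff _ _

theorem isRegularTypeMap : IsRegularTypeMap D.simple Y.typeMap where
  exists_glb u v := ⟨⟨u.1 ⊓ v.1, inf_mem_crossSection u.2 v.2⟩, by
    rw [isGLB_iff_le_iff]
    intro w
    rw [mem_lowerBounds]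
    simp only [Set.mem_insert_iff, Set.mem_singleton_iff, forall_eq_or_imp, forall_eq]
    exact le_inf_iff (α := Y.Face)⟩
  exists_top := ⟨⟨⊤, top_mem_crossSection⟩, fun u => (le_top : u.1 ≤ ⊤),
    Set.eq_univ_of_forall fun i => smul_top _, fun x => by
      rw [← pairsToFace_le_iff, pairsToFace_mk, one_smul]
      exact le_top⟩
  refl x := (pairsToFace_le_iff x x).1 le_rfl
  antisymm x y h h' := pairsToFace_bijective.1
    (le_antisymm ((pairsToFace_le_iff x y).2 h) ((pairsToFace_le_iff y x).2 h'))
  trans x y z h h' := (pairsToFace_le_iff x z).1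
    (((pairsToFace_le_iff x y).2 h).trans ((pairsToFace_le_iff y z).2 h'))
  exists_meet x y := by
    obtain ⟨z, hz⟩ := pairsToFace_bijective.2 (pairsToFace x ⊓ pairsToFace y)
    refine ⟨z, ?_, ?_, fun w h h' => ?_⟩
    · rw [← pairsToFace_le_iff, hz]
      exact inf_le_left
    · rw [← pairsToFace_le_iff, hz]
      exact inf_le_right
    · rw [← pairsToFace_le_iff] at h h' ⊢
      rw [hz]
      exact le_inf h h'

end InvariantSubcone

/-! ### The monoid of a face lattice -/

namespace InvariantSubcone

open LinearCoxeterSystem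

variable {ι V : Type*} [NormedAddCommGroup V] [NormedSpace ℝ V]
  {D : LinearCoxeterSystem ι V} {Y : InvariantSubcone D}

theorem bracket_mul (σ τ : D.W) (R T : Y.Face) :
    Y.bracket σ R * Y.bracket τ T = Y.bracket (σ * τ) (τ⁻¹ • R ⊓ T) := rfl

theorem bracket_one_top : Y.bracket 1 ⊤ = 1 := rfl

theorem bracket_eq_iff {σ τ : D.W} {R T : Y.Face} :
    Y.bracket σ R = Y.bracket τ T ↔ R = T ∧ Y.Fixes (σ⁻¹ * τ) R := Y.rennerCon.eq

theorem exists_bracket_eq (x : Y.RennerMonoid) : ∃ σ R, Y.bracket σ R = x := by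
  obtain ⟨⟨σ, R⟩, rfl⟩ := Con.mk'_surjective x
  exact ⟨σ, R, rfl⟩

theorem bracket_top_mul (σ τ : D.W) (T : Y.Face) :
    Y.bracket σ ⊤ * Y.bracket τ T = Y.bracket (σ * τ) T := by
  rw [bracket_mul, smul_top, top_inf_eq]

theorem bracket_mul_top (σ τ : D.W) (R : Y.Face) :
    Y.bracket σ R * Y.bracket τ ⊤ = Y.bracket (σ * τ) (τ⁻¹ • R) := by
  rw [bracket_mul, inf_top_eq]

theorem bracket_one_mul (R T : Y.Face) :
    Y.bracket 1 R * Y.bracket 1 T = Y.bracket 1 (R ⊓ T) := by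
  rw [bracket_mul, inv_one, one_smul, one_mul]

theorem bracket_one_injective : Function.Injective (Y.bracket 1) :=
  fun _ _ h => (bracket_eq_iff.1 h).1

theorem Fixes.inv {σ : D.W} {R : Y.Face} (h : Y.Fixes σ R) : Y.Fixes σ⁻¹ R := fun x hx => by
  conv_lhs => rw [← h x hx, D.inv_apply_self]

theorem Fixes.smul_eq {σ : D.W} {R : Y.Face} (h : Y.Fixes σ R) : σ • R = R := by
  have hle : ∀ τ : D.W, Y.Fixes τ R → τ • R ≤ R := fun τ hτ x hx => by
    have hx' := (mem_smul_iff τ R x).1 hx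
    rw [← hτ _ hx', D.apply_inv_self] at hx'
    exact hx'
  refine le_antisymm (hle σ h) ?_
  rw [← smul_le_smul_iff σ⁻¹, inv_smul_smul]
  exact hle _ h.inv

theorem isIdempotentElem_bracket_one (R : Y.Face) : IsIdempotentElem (Y.bracket 1 R) := by
  rw [IsIdempotentElem, bracket_one_mul, inf_idem]

/-- Comparing (σ, R)² with (σ, R) shows that σ⁻¹ fixes R pointwise, so σ may be replaced by 1. -/
theorem exists_bracket_one_eq {e : Y.RennerMonoid} (he : IsIdempotentElem e) :
    ∃ R, Y.bracket 1 R = e := by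
  obtain ⟨σ, R, rfl⟩ := exists_bracket_eq e
  refine ⟨R, bracket_eq_iff.2 ⟨rfl, ?_⟩⟩
  obtain ⟨h1, h2⟩ := bracket_eq_iff.1 he
  rw [h1] at h2
  have h3 : (σ * σ)⁻¹ * σ = σ⁻¹ := by group
  rw [h3] at h2
  simpa using h2.inv

/-- The homomorphism `σ ↦ σ⌈Y⌉` from the group into the units of the monoid. -/
noncomputable def unitHom (Y : InvariantSubcone D) : D.W →* Y.RennerMonoidˣ :=
  MonoidHom.toHomUnits
    { toFun := fun σ => Y.bracket σ ⊤
      map_one' := rfl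
      map_mul' := fun σ τ => (bracket_top_mul σ τ ⊤).symm }

theorem coe_unitHom (σ : D.W) : (Y.unitHom σ : Y.RennerMonoid) = Y.bracket σ ⊤ := rfl

theorem unitHom_conj (σ : D.W) (R : Y.Face) :
    (Y.unitHom σ : Y.RennerMonoid) * Y.bracket 1 R * ((Y.unitHom σ)⁻¹ : Y.RennerMonoidˣ) =
      Y.bracket 1 (σ • R) := by
  rw [← map_inv, coe_unitHom, coe_unitHom, bracket_top_mul, bracket_mul_top, mul_one,
    mul_inv_cancel, inv_inv]

theorem unitHom_comm_iff {σ : D.W} {R : Y.Face} :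
    (Y.unitHom σ : Y.RennerMonoid) * Y.bracket 1 R = Y.bracket 1 R * Y.unitHom σ ↔
      σ • R = R := by
  rw [coe_unitHom, bracket_top_mul, bracket_mul_top, mul_one, one_mul, bracket_eq_iff,
    eq_inv_smul_iff]
  refine and_iff_left fun x _ => ?_
  rw [inv_mul_cancel, one_apply]

theorem mul_unitHom_eq_iff {σ : D.W} {R : Y.Face} :
    Y.bracket 1 R * Y.unitHom σ = Y.bracket 1 R ↔ Y.Fixes σ R := by
  rw [coe_unitHom, bracket_mul_top, one_mul, bracket_eq_iff, mul_one]
  refine ⟨fun ⟨h1, h2⟩ => ?_, fun h => ?_⟩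
  · rw [h1] at h2
    simpa using h2.inv
  · rw [h.inv.smul_eq]
    exact ⟨rfl, h.inv⟩

theorem unitHom_comm_and_mul_eq_iff {σ : D.W} {R : Y.Face} :
    ((Y.unitHom σ : Y.RennerMonoid) * Y.bracket 1 R = Y.bracket 1 R * Y.unitHom σ ∧
      Y.bracket 1 R * Y.unitHom σ = Y.bracket 1 R) ↔ Y.Fixes σ R := by
  rw [unitHom_comm_iff, mul_unitHom_eq_iff]
  exact and_iff_right_of_imp Fixes.smul_eq

theorem unitHom_bijective (hfaith : ∀ σ : D.W, (∀ lam ∈ Y.cone, σ.1 lam = lam) → σ = 1) :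
    Function.Bijective Y.unitHom := by
  constructor
  · rw [injective_iff_map_eq_one]
    intro σ h
    have h1 : Y.bracket σ ⊤ = Y.bracket 1 ⊤ := congrArg Units.val h
    have h2 := (bracket_eq_iff.1 h1).2.inv
    rw [mul_one, inv_inv] at h2
    exact hfaith σ h2
  · intro u
    obtain ⟨σ, R, hu⟩ := exists_bracket_eq (u : Y.RennerMonoid)
    obtain ⟨τ, T, hv⟩ := exists_bracket_eq ((u⁻¹ : Y.RennerMonoidˣ) : Y.RennerMonoid)
    have h1 : Y.bracket τ T * Y.bracket σ R = Y.bracket 1 ⊤ := by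
      rw [hu, hv, bracket_one_top, Units.inv_mul]
    -- The face of a product is contained in the face of its right factor, so a unit has face Y.
    have h2 : R = ⊤ := (inf_eq_top_iff.1 (bracket_eq_iff.1 h1).1).2
    exact ⟨σ, Units.ext (by rw [coe_unitHom, ← hu, h2])⟩

/-- The bijection `R ↦ 1⌈R⌉` from the faces onto the idempotents. -/
noncomputable def idempotentEquiv (Y : InvariantSubcone D) :
    Y.Face ≃ {e : Y.RennerMonoid // IsIdempotentElem e} :=
  Equiv.ofBijective (fun R => ⟨Y.bracket 1 R, isIdempotentElem_bracket_one R⟩)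
    ⟨fun _ _ h => bracket_one_injective (congrArg Subtype.val h), fun e => by
      obtain ⟨R, hR⟩ := exists_bracket_one_eq e.2
      exact ⟨R, Subtype.ext hR⟩⟩

theorem le_iff_idemLE {R T : Y.Face} : R ≤ T ↔ IdemLE (Y.bracket 1 R) (Y.bracket 1 T) := by
  rw [IdemLE, bracket_one_mul, bracket_one_mul, bracket_one_injective.eq_iff,
    bracket_one_injective.eq_iff, inf_eq_left, inf_eq_right, and_self]

theorem isFactorisable : IsFactorisable Y.RennerMonoid where
  idem_mul e f he hf := by
    obtain ⟨R, rfl⟩ := exists_bracket_one_eq he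
    obtain ⟨T, rfl⟩ := exists_bracket_one_eq hf
    rw [bracket_one_mul]
    exact isIdempotentElem_bracket_one _
  idem_comm e f he hf := by
    obtain ⟨R, rfl⟩ := exists_bracket_one_eq he
    obtain ⟨T, rfl⟩ := exists_bracket_one_eq hf
    rw [bracket_one_mul, bracket_one_mul, inf_comm]
  unit_mul_idem x := by
    obtain ⟨σ, R, rfl⟩ := exists_bracket_eq x
    exact ⟨Y.unitHom σ, Y.bracket 1 R, isIdempotentElem_bracket_one R, by
      rw [coe_unitHom, bracket_top_mul, mul_one]⟩
  idem_mul_unit x := by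
    obtain ⟨σ, R, rfl⟩ := exists_bracket_eq x
    exact ⟨Y.bracket 1 (σ • R), Y.unitHom σ, isIdempotentElem_bracket_one _, by
      rw [coe_unitHom, bracket_mul_top, one_mul, inv_smul_smul]⟩

/-- The isomorphism `σ ↦ σ⌈Y⌉` of a faithfully acting group onto the unit group. -/
noncomputable def unitEquiv (hfaith : ∀ σ : D.W, (∀ lam ∈ Y.cone, σ.1 lam = lam) → σ = 1) :
    D.W ≃* Y.RennerMonoidˣ :=
  MulEquiv.ofBijective Y.unitHom (unitHom_bijective hfaith)

theorem rennerType_eq (R : Y.crossSection) :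
    rennerType (Set.range fun i => Y.unitHom (D.simple i)) (Y.bracket 1 R.1) =
      (fun i => Y.unitHom (D.simple i)) '' Y.typeMap R := by
  ext s
  constructor
  · rintro ⟨⟨i, rfl⟩, h⟩
    exact ⟨i, unitHom_comm_iff.1 h, rfl⟩
  · rintro ⟨i, hi, rfl⟩
    exact ⟨⟨i, rfl⟩, unitHom_comm_iff.2 hi⟩

theorem rennerLowerType_eq (R : Y.crossSection) :
    rennerLowerType (Set.range fun i => Y.unitHom (D.simple i)) (Y.bracket 1 R.1) =
      (fun i => Y.unitHom (D.simple i)) '' Y.lowerTypeMap R := by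
  ext s
  constructor
  · rintro ⟨⟨i, rfl⟩, h⟩
    exact ⟨i, unitHom_comm_and_mul_eq_iff.1 h, rfl⟩
  · rintro ⟨i, hi, rfl⟩
    exact ⟨⟨i, rfl⟩, unitHom_comm_and_mul_eq_iff.2 hi⟩

theorem rennerUpperType_eq (R : Y.crossSection) :
    rennerUpperType (Set.range fun i => Y.unitHom (D.simple i)) (Y.bracket 1 R.1) =
      (fun i => Y.unitHom (D.simple i)) '' Y.upperTypeMap R := by
  ext s
  constructor
  · rintro ⟨⟨i, rfl⟩, h, h'⟩
    exact ⟨i, ⟨unitHom_comm_iff.1 h, fun hf => h' (mul_unitHom_eq_iff.2 hf)⟩, rfl⟩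
  · rintro ⟨i, ⟨hi, hi'⟩, rfl⟩
    exact ⟨⟨i, rfl⟩, unitHom_comm_iff.2 hi, fun hf => hi' (mul_unitHom_eq_iff.1 hf)⟩

theorem closure_image_unitHom (J : Set ι) :
    Subgroup.closure ((fun i => Y.unitHom (D.simple i)) '' J) =
      (standardParabolic D.simple J).map Y.unitHom := by
  rw [standardParabolic, MonoidHom.map_closure, Set.image_image]

variable [FiniteDimensional ℝ V] [Finite ι]

theorem isGeneralizedRennerCoxeterSystem
    (hfaith : ∀ σ : D.W, (∀ lam ∈ Y.cone, σ.1 lam = lam) → σ = 1) :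
    IsGeneralizedRennerCoxeterSystem Y.RennerMonoid (Y.bracket 1 '' Y.crossSection)
      (Set.range fun i => Y.unitHom (D.simple i)) where
  factorisable := isFactorisable
  coxeter := by
    obtain ⟨m, cs, hcs⟩ := D.descentRelation.exists_coxeterSystem D.simple_injective
    have hinj : Function.Injective fun i => Y.unitHom (D.simple i) :=
      (unitHom_bijective hfaith).1.comp D.simple_injective
    -- Transport the Coxeter system from 𝒲 to the units and index it by the set of generators
    -- itself, which injectivity permits.
    refine ⟨_, (cs.map (unitEquiv hfaith)).reindex (Equiv.ofInjective _ hinj), fun s => ?_⟩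
    rw [CoxeterSystem.reindex_simple, CoxeterSystem.map_simple, hcs]
    exact congrArg Subtype.val ((Equiv.ofInjective _ hinj).apply_symm_apply s)
  idem := by
    rintro _ ⟨R, -, rfl⟩
    exact isIdempotentElem_bracket_one R
  mul_mem := by
    rintro _ ⟨R, hR, rfl⟩ _ ⟨T, hT, rfl⟩
    exact ⟨R ⊓ T, inf_mem_crossSection hR hT, (bracket_one_mul R T).symm⟩
  cross_section e he := by
    obtain ⟨R, rfl⟩ := exists_bracket_one_eq he
    obtain ⟨σ, S, hS, rfl⟩ := exists_smul_mem_crossSection R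
    refine ⟨Y.bracket 1 S, ⟨⟨S, hS, rfl⟩, Y.unitHom σ, (unitHom_conj σ S).symm⟩, ?_⟩
    rintro _ ⟨⟨T, hT, rfl⟩, x, hx⟩
    obtain ⟨τ, rfl⟩ := (unitHom_bijective hfaith).2 x
    rw [unitHom_conj] at hx
    rw [(eq_and_mem_of_smul_eq (σ := σ⁻¹ * τ) hT hS
      (by rw [mul_smul, ← bracket_one_injective hx, inv_smul_smul])).1]
  pairs e₁ e₂ h₁ h₂ hle := by
    obtain ⟨R, rfl⟩ := exists_bracket_one_eq h₁
    obtain ⟨T, rfl⟩ := exists_bracket_one_eq h₂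
    obtain ⟨σ, S, hS, S', hS', hSS', rfl, rfl⟩ := exists_smul_pair (le_iff_idemLE.2 hle)
    exact ⟨Y.unitHom σ, _, ⟨S, hS, rfl⟩, _, ⟨S', hS', rfl⟩, le_iff_idemLE.1 hSS',
      (unitHom_conj σ S).symm, (unitHom_conj σ S').symm⟩
  centralizer_parabolic := by
    rintro _ ⟨R, hR, rfl⟩
    refine ⟨_, Set.image_subset_range _ (faceType R), ?_⟩
    rw [closure_image_unitHom]
    ext x
    obtain ⟨σ, rfl⟩ := (unitHom_bijective hfaith).2 x
    rw [SetLike.mem_coe, Subgroup.mem_map_iff_mem (unitHom_bijective hfaith).1,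
      ← smul_eq_self_iff hR, Set.mem_ofPred_eq, unitHom_comm_iff]
  stabilizer_parabolic := by
    rintro _ ⟨R, hR, rfl⟩
    refine ⟨_, Set.image_subset_range _ (faceLowerType R), ?_⟩
    rw [closure_image_unitHom]
    ext x
    obtain ⟨σ, rfl⟩ := (unitHom_bijective hfaith).2 x
    rw [SetLike.mem_coe, Subgroup.mem_map_iff_mem (unitHom_bijective hfaith).1,
      ← fixes_iff hR, Set.mem_ofPred_eq, unitHom_comm_and_mul_eq_iff]
  upper_monotone := by
    rintro _ ⟨R, hR, rfl⟩ _ ⟨T, hT, rfl⟩ hle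
    rw [rennerUpperType_eq ⟨R, hR⟩, rennerUpperType_eq ⟨T, hT⟩]
    exact Set.image_mono fun i hi =>
      upper_type_mono hR hT (le_iff_idemLE.2 hle) hi.1 hi.2

end InvariantSubcone

theorem mainTheorem6 {ι V : Type*} [Finite ι]
    [NormedAddCommGroup V] [NormedSpace ℝ V] [FiniteDimensional ℝ V]
    (D : LinearCoxeterSystem ι V) (Y : InvariantSubcone D) :
    -- the cross section is a complete sublattice of the face lattice
    (∃ L : CompleteSublattice Y.Face, (L : Set Y.Face) = Y.crossSection) ∧
    -- every chain of faces is a translate of a unique chain in the cross section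
    (∀ (m : ℕ) (R : Fin m → Y.Face), Monotone R →
      ∃! S : Fin m → Y.Face, Monotone S ∧ (∀ i, S i ∈ Y.crossSection) ∧
        ∃ σ : D.W, ∀ i, R i = σ • S i) ∧
    -- the type map is a regular type map
    IsRegularTypeMap D.simple Y.typeMap ∧
    -- the associated semilattice is isomorphic to the face lattice
    (∃ Φ : TypeMapPairs D.simple Y.typeMap ≃o Y.Face,
      ∀ (R : Y.crossSection) (σ : D.W),
        Φ (TypeMapPairs.mk D.simple Y.typeMap R σ) = σ • R.1) ∧
    -- the generalized Renner–Coxeter system of `Y`, if the group acts faithfully on `Y`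
    ((∀ σ : D.W, (∀ lam ∈ Y.cone, σ.1 lam = lam) → σ = 1) →
      ∃ (φ : D.W ≃* Y.RennerMonoidˣ) (ψ : Y.Face ≃ {e : Y.RennerMonoid // IsIdempotentElem e}),
        (∀ σ, (φ σ : Y.RennerMonoid) = Y.bracket σ ⊤) ∧
        (∀ R, (ψ R : Y.RennerMonoid) = Y.bracket 1 R) ∧
        (∀ R T, R ≤ T ↔ IdemLE (ψ R : Y.RennerMonoid) (ψ T)) ∧
        IsGeneralizedRennerCoxeterSystem Y.RennerMonoid
          (Y.bracket 1 '' Y.crossSection) (Set.range fun i => φ (D.simple i)) ∧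
        (Function.Injective fun i => φ (D.simple i)) ∧
        ∀ R : Y.crossSection,
          rennerType (Set.range fun i => φ (D.simple i)) (Y.bracket 1 R.1) =
            (fun i => φ (D.simple i)) '' Y.typeMap R ∧
          rennerLowerType (Set.range fun i => φ (D.simple i)) (Y.bracket 1 R.1) =
            (fun i => φ (D.simple i)) '' Y.lowerTypeMap R ∧
          rennerUpperType (Set.range fun i => φ (D.simple i)) (Y.bracket 1 R.1) =
            (fun i => φ (D.simple i)) '' Y.upperTypeMap R) := by

  refine ⟨InvariantSubcone.exists_completeSublattice,
    fun _ R hR => InvariantSubcone.existsUnique_chain R hR, InvariantSubcone.isRegularTypeMap,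
    ⟨InvariantSubcone.pairsOrderIso, InvariantSubcone.pairsToFace_mk⟩, fun hfaith =>
    ⟨InvariantSubcone.unitEquiv hfaith, Y.idempotentEquiv, fun _ => rfl, fun _ => rfl,
      fun _ _ => InvariantSubcone.le_iff_idemLE,
      InvariantSubcone.isGeneralizedRennerCoxeterSystem hfaith,
      (InvariantSubcone.unitHom_bijective hfaith).1.comp D.simple_injective, fun R =>
      ⟨InvariantSubcone.rennerType_eq R, InvariantSubcone.rennerLowerType_eq R,
        InvariantSubcone.rennerUpperType_eq R⟩⟩⟩
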